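/- For integers $p,q\ge 3$ put $\xi_p=\sqrt2\,\sqrt{7-\cos(2\pi/p)}$, $$\rho^*_{p,q}=\Bigl(\cos\tfrac{\pi}{p}\cos\tfrac{\pi}{q}+\tfrac12\sin\tfrac{\pi}{q}\bigl(4\sin\tfrac{\pi}{p}+\xi_p\bigr)\Bigr)+i\Bigl(\tfrac{\xi_p}{2}\cos\tfrac{\pi}{q}+\cos\tfrac{\pi}{p}\sin\tfrac{\pi}{q}\Bigr),$$ $$x_{p,q}=\frac{\cos\bigl(\frac{2\pi}{p}-\frac{2\pi}{q}\bigr)-\cos\frac{2\pi}{p}-\cos\frac{2\pi}{q}+\xi_p\bigl(\sin\frac{\pi}{p}-\sin(\frac{\pi}{p}-\frac{2\pi}{q})\bigr)+5}{\cos\frac{\pi}{p}\cos\frac{\pi}{q}+\frac12\sin\frac{\pi}{q}\bigl(4\sin\frac{\pi}{p}+\xi_p\bigr)}.$$ The *symmetry* of a set means its reflection in the line $\operatorname{Re} z=2\sin\frac{\pi}{p}\sin\frac{\pi}{q}$. Let $\Omega_{p,q}$ be the open region bounded by the following lines, that is, the connected component containing $2\sin\frac{\pi}{p}\sin\frac{\pi}{q}$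 of the complement of their union: 1. the line $\operatorname{Re} z=2+2\cos(\frac{\pi}{p}-\frac{\pi}{q})$ and its symmetry; 2. the two lines $\operatorname{Im} z=\pm2\sqrt{1-\sin^2\frac{\pi}{p}\sin^2\frac{\pi}{q}}$; 3. the line through $\rho^*_{p,q}$ and $x_{p,q}$, its complex conjugate, and their symmetries; 4. the line through $\rho^*_{q,p}$ and $x_{q,p}$, its complex conjugate, and their symmetries. With $\alpha=e^{i\pi/p}$ and $\beta=e^{i\pi/q}$, let $A=\begin{pmatrix}\alpha&1\\0&\alpha^{-1}\end{pmatrix}$ and $B_\rho=\begin{pmatrix}\beta&0\\\rho&\beta^{-1}\end{pmatrix}$ in $\mathrm{PSL}(2,\mathbb C)$. Let $\overline{\mathcal R}_{p,q}$ be the set of $\rho\in\mathbb C$ such that $\Gamma_\rho=\langle A,B_\rho\rangle$ is discrete and is the free product of $\langle A\rangle$ and $\langle B_\rho\rangle$, and let $\mathcal R_{p,q}$ be its interior. A *cusp group* is a point $\rho\in\overline{\mathcal R}_{p,q}$ on the boundary of $\mathcal R_{p,q}$ for which $\Gamma_\rho$ contains a parabolic element. **Corollary.** Let $p=q\ge3$.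 Then $\Omega_{p,p}$ is the open region around $2\sin^2\frac{\pi}{p}$ bounded by the following six lines, which are pairwise distinct: the two lines $\operatorname{Im} z=\pm2\sqrt{1-\sin^4\frac{\pi}{p}}$, the line through $\rho^*_{p,p}$ and $4$, its complex conjugate, and the symmetries of these last two lines. This region is the interior of a (non-degenerate) convex hexagon, and each of the six lines cuts out exactly one of its six closed edges. On each of the six closed edges there lies a cusp group $\rho$. -/

import Mathlib

open Complex

noncomputable section

/-! ## The groups generated by two elliptic elements -/

/-- The matrix with rows `(α, 1)` and `(0, α⁻¹)`. -/
def genA (α : ℂˣ) : Matrix.SpecialLinearGroup (Fin 2) ℂ :=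
  ⟨!![(α : ℂ), 1; 0, (α : ℂ)⁻¹], by simp [Matrix.det_fin_two]⟩

/-- The matrix with rows `(β, 0)` and `(ρ, β⁻¹)`. -/
def genB (β : ℂˣ) (ρ : ℂ) : Matrix.SpecialLinearGroup (Fin 2) ℂ :=
  ⟨!![(β : ℂ), 0; ρ, (β : ℂ)⁻¹], by simp [Matrix.det_fin_two]⟩

/-- The group `PSL(2, ℂ)`, with the quotient topology. -/
abbrev PSL2C : Type := Matrix.ProjectiveSpecialLinearGroup (Fin 2) ℂ

/-- The class in `PSL(2, ℂ)` of a matrix of `SL(2, ℂ)`. -/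
def toPSL : Matrix.SpecialLinearGroup (Fin 2) ℂ →* PSL2C :=
  QuotientGroup.mk' (Subgroup.center (Matrix.SpecialLinearGroup (Fin 2) ℂ))

/-- The subgroup of `PSL(2, ℂ)` generated by `A` and `B_ρ`. -/
def groupGamma (α β : ℂˣ) (ρ : ℂ) : Subgroup PSL2C :=
  Subgroup.closure {toPSL (genA α), toPSL (genB β ρ)}

/-- The subgroup `⟨a, b⟩` of `G` is the free product `⟨a⟩ * ⟨b⟩`: the canonical homomorphism from
the free product of the two cyclic subgroups to `G` (whose image is `⟨a, b⟩`) is injective. -/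
def FreelyGenerate {G : Type*} [Group G] (a b : G) : Prop :=
  Function.Injective
    (Monoid.Coprod.lift (Subgroup.zpowers a).subtype (Subgroup.zpowers b).subtype)

/-- The set of `ρ` for which the group generated by `A` and `B_ρ` is discrete in `PSL(2, ℂ)` and
is freely generated by `A` and `B_ρ`. -/
def closedDeformationSpace (α β : ℂˣ) : Set ℂ :=
  {ρ | DiscreteTopology (groupGamma α β ρ) ∧
    FreelyGenerate (toPSL (genA α)) (toPSL (genB β ρ))}

/-- The (open) deformation space. -/
def deformationSpace (α β : ℂˣ) : Set ℂ :=
  interior (closedDeformationSpace α β)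

/-- An element of `PSL(2, ℂ)` is parabolic: it is represented by a non-scalar matrix with
a double eigenvalue. -/
def IsParabolicPSL (g : PSL2C) : Prop :=
  ∃ M : Matrix.SpecialLinearGroup (Fin 2) ℂ,
    toPSL M = g ∧ (M : Matrix (Fin 2) (Fin 2) ℂ).IsParabolic

/-- The number `e^{iπ/n}`. -/
def expRoot (n : ℕ) : ℂˣ :=
  Units.mk0 (Complex.exp (Real.pi * I / n)) (Complex.exp_ne_zero _)

/-- The point `ρ` is a cusp group of the deformation space of `ℤ/p * ℤ/q` (`p` and `q` finite):
it lies on the boundary of the deformation space, its group is discrete and freely generated by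
`A` and `B_ρ`, and this group contains a parabolic element. As the two generators have finite
order, such a parabolic element is accidental. -/
def IsCuspGroup (p q : ℕ) (ρ : ℂ) : Prop :=
  ρ ∈ frontier (deformationSpace (expRoot p) (expRoot q)) ∧
  ρ ∈ closedDeformationSpace (expRoot p) (expRoot q) ∧
  ∃ g ∈ groupGamma (expRoot p) (expRoot q) ρ, IsParabolicPSL g

/-! ## The lines and the regions that they bound -/

/-- `ξ = √2 √(7 - cos(2π/p))`. -/
def xi (p : ℕ) : ℝ := √2 * √(7 - Real.cos (2 * Real.pi / p))

/-- The real part of `ρ*_{p,q}`. -/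
def rhoStarRe (p q : ℕ) : ℝ :=
  Real.cos (Real.pi / p) * Real.cos (Real.pi / q)
    + 1 / 2 * Real.sin (Real.pi / q) * (4 * Real.sin (Real.pi / p) + xi p)

/-- The imaginary part of `ρ*_{p,q}`. -/
def rhoStarIm (p q : ℕ) : ℝ :=
  xi p / 2 * Real.cos (Real.pi / q) + Real.cos (Real.pi / p) * Real.sin (Real.pi / q)

/-- The point `ρ*_{p,q}`. -/
def rhoStar (p q : ℕ) : ℂ := ⟨rhoStarRe p q, rhoStarIm p q⟩

/-- The real number `x_{p,q}`. -/
def xStar (p q : ℕ) : ℝ :=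
  (Real.cos (2 * Real.pi / p - 2 * Real.pi / q) - Real.cos (2 * Real.pi / p)
      - Real.cos (2 * Real.pi / q)
      + xi p * (Real.sin (Real.pi / p) - Real.sin (Real.pi / p - 2 * Real.pi / q)) + 5)
    / (Real.cos (Real.pi / p) * Real.cos (Real.pi / q)
      + 1 / 2 * Real.sin (Real.pi / q) * (4 * Real.sin (Real.pi / p) + xi p))

/-- The line `{t a + (1 - t) b : t ∈ ℝ}`. -/
def lineThrough (a b : ℂ) : Set ℂ := {z | ∃ t : ℝ, z = t * a + (1 - t) * b}

/-- The complex conjugate of a set. -/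
def conjSet (S : Set ℂ) : Set ℂ := (fun z => (starRingEnd ℂ) z) '' S

/-- The center of symmetry `2 sin(π/p) sin(π/q)`. -/
def symCenter (p q : ℕ) : ℝ := 2 * Real.sin (Real.pi / p) * Real.sin (Real.pi / q)

/-- The symmetry of a set: its reflection in the line `Re z = 2 sin(π/p) sin(π/q)`. -/
def symSet (p q : ℕ) (S : Set ℂ) : Set ℂ :=
  (fun z => ((2 * symCenter p q : ℝ) : ℂ) - (starRingEnd ℂ) z) '' S

/-- The horizontal line `Im z = h`. -/
def horizontalLine (h : ℝ) : Set ℂ := {z | z.im = h}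

/-- The vertical line `Re z = x`. -/
def verticalLine (x : ℝ) : Set ℂ := {z | z.re = x}

/-- The height `2 √(1 - sin²(π/p) sin²(π/q))`. -/
def height (p q : ℕ) : ℝ :=
  2 * √(1 - Real.sin (Real.pi / p) ^ 2 * Real.sin (Real.pi / q) ^ 2)

/-- A line, its complex conjugate, and the symmetries of these two. -/
def lineFamily (p q : ℕ) (L : Set ℂ) : Set (Set ℂ) :=
  {L, conjSet L, symSet p q L, symSet p q (conjSet L)}

/-- The lines that bound `Ω_{p,q}`. -/
def boundingLines (p q : ℕ) : Set (Set ℂ) :=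
  {verticalLine (2 + 2 * Real.cos (Real.pi / p - Real.pi / q)),
    symSet p q (verticalLine (2 + 2 * Real.cos (Real.pi / p - Real.pi / q)))} ∪
  {horizontalLine (height p q), horizontalLine (-height p q)} ∪
  lineFamily p q (lineThrough (rhoStar p q) (xStar p q)) ∪
  lineFamily p q (lineThrough (rhoStar q p) (xStar q p))

/-- The open region around the point `c` that is bounded by a family of lines: the connected
component of `c` in the complement of the lines. -/
def regionAround (c : ℂ) (𝓛 : Set (Set ℂ)) : Set ℂ := connectedComponentIn (⋃₀ 𝓛)ᶜ c

/-- The region `Ω_{p,q}`. -/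
def regionOmega (p q : ℕ) : Set ℂ := regionAround (symCenter p q : ℂ) (boundingLines p q)

/-- The line through `ρ*_{p,p}` and `4`. -/
def slantedLine (p : ℕ) : Set ℂ := lineThrough (rhoStar p p) 4

/-- The six lines of the case `p = q`, in cyclic order around the hexagon. -/
def hexagonLine (p : ℕ) : Fin 6 → Set ℂ :=
  ![slantedLine p,
    horizontalLine (2 * √(1 - Real.sin (Real.pi / p) ^ 4)),
    symSet p p (slantedLine p),
    symSet p p (conjSet (slantedLine p)),
    horizontalLine (-(2 * √(1 - Real.sin (Real.pi / p) ^ 4))),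
    conjSet (slantedLine p)]

/-- `Ω` is an open convex hexagon with vertices `v 0, …, v 5` in cyclic order (each of them
a genuine vertex), whose `i`-th edge, from `v i` to `v (i + 1)`, is cut out by the line `ℓ i`. -/
def IsHexagon (Ω : Set ℂ) (v : Fin 6 → ℂ) (ℓ : Fin 6 → Set ℂ) : Prop :=
  ConvexIndependent ℝ v ∧
  Ω = interior (convexHull ℝ (Set.range v)) ∧
  frontier Ω = ⋃ i, segment ℝ (v i) (v (i + 1)) ∧
  ∀ i, ℓ i ∩ closure Ω = segment ℝ (v i) (v (i + 1))

end

open Filter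
open scoped ComplexConjugate Topology

/-! Write s = sin(π/p) and c = cos(π/p). For p = q both slanted families coincide, and the slanted
line is Re z + κ Im z = 4 with κ = (√(3+s²) - 2s)/c. The four slanted lines bound a rhombus with
centre 2s² and vertices 4 and 4s² - 4 on the real axis. The horizontal lines cut off its two other
corners because κ·2√(1-s⁴) < 4 - 2s², and the vertical lines only touch the resulting hexagon at its
real vertices.

Four cusp groups serve the six edges: the vertices 4 and 4s² - 4, each shared by two slanted edges,
and the midpoints 2s² ± 2i√(1-s⁴) of the horizontal ones. At these points the words AB⁻¹, AB and
ABA⁻¹B⁻¹, of traces 2 - ρ, ρ + 2 - 4s² and (ρ - 2s²)² + 2 - 4s⁴ respectively, have trace -2.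

Discreteness and freeness come from ping-pong. A sector of angle 2π/p at the finite fixed point of A
and a lune between the fixed points of B_ρ are fundamental domains of the cyclic groups; it suffices
that the exterior of the lune lies in the sector. For each pair of sides this is the
semidefiniteness of a Hermitian form (`hermitian_form_nonneg`,
`PingPong.mem_closedDeformationSpace`).

These inequalities become strict at τρ for τ > 1, so ρ is in the closure of the deformation space.
It is not in the interior: at points arbitrarily near, the word has trace -2cos(π/m) and finite
order, and a relation in one free product carries over to Γ_ρ, where the word is parabolic
(`PingPong.isCuspGroup`). -/

/-! ### Free products: ping-pong and transfer of relations -/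

/-- A form of the ping-pong lemma for two subgroups `H` and `K`, with a set `U` of starting points:
a nontrivial element of the free product moves every point of `U` out of `U`. -/
theorem coprod_lift_smul_notMem {G α : Type*} [Group G] [MulAction G α] {H K : Subgroup G}
    {X Y U : Set α} (hXU : Disjoint X U) (hYU : Disjoint Y U)
    (hH : ∀ h ∈ H, h ≠ 1 → ∀ u ∈ U ∪ Y, h • u ∈ X)
    (hK : ∀ k ∈ K, k ≠ 1 → ∀ u ∈ U ∪ X, k • u ∈ Y)
    {g : Monoid.Coprod H K} (hg : g ≠ 1) {u : α} (hu : u ∈ U) :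
    Monoid.Coprod.lift H.subtype K.subtype g • u ∉ U := by
  classical
  -- The binary free product becomes one indexed by `Bool`, whose nontrivial elements are reduced
  -- words (`NeWord`).
  let F : Bool → Subgroup G := fun | true => H | false => K
  let Z : Bool → Set α := fun | true => X | false => Y
  let of (b : Bool) : ↥(F b) →* Monoid.CoprodI (fun b => ↥(F b)) :=
    @Monoid.CoprodI.of Bool (fun b => ↥(F b)) _ b
  let toI : Monoid.Coprod H K →* Monoid.CoprodI (fun b => ↥(F b)) :=
    Monoid.Coprod.lift (of true) (of false)
  let ofI : Monoid.CoprodI (fun b => ↥(F b)) →* Monoid.Coprod H K :=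
    Monoid.CoprodI.lift (fun b => Bool.rec (Monoid.Coprod.inr : K →* Monoid.Coprod H K)
      (Monoid.Coprod.inl : H →* Monoid.Coprod H K) b)
  have hof : ofI.comp toI = MonoidHom.id _ := by
    ext x <;> simp [toI, ofI, of]
  let ev : Monoid.CoprodI (fun b => ↥(F b)) →* G := Monoid.CoprodI.lift (fun b => (F b).subtype)
  have hev : ev.comp toI = Monoid.Coprod.lift H.subtype K.subtype := by
    ext x <;> simp [toI, ev, F, of]
  have hstep : ∀ b (x : F b), x ≠ 1 → ∀ v, (v ∈ U ∨ ∃ b', b ≠ b' ∧ v ∈ Z b') →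
      (x : G) • v ∈ Z b := by
    rintro (_ | _) x hx v hv
    · refine hK x x.2 (fun h => hx (Subtype.ext h)) v ?_
      rcases hv with hv | ⟨_ | _, hb, hv⟩
      · exact Or.inl hv
      · exact absurd rfl hb
      · exact Or.inr hv
    · refine hH x x.2 (fun h => hx (Subtype.ext h)) v ?_
      rcases hv with hv | ⟨_ | _, hb, hv⟩
      · exact Or.inl hv
      · exact Or.inr hv
      · exact absurd rfl hb
  -- Induction on the reduced word: its last letter restricts the starting point, and its first
  -- letter determines where the image lies.
  have hword : ∀ i j (w : Monoid.CoprodI.NeWord (fun b => ↥(F b)) i j) v,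
      (v ∈ U ∨ ∃ b', j ≠ b' ∧ v ∈ Z b') → ev w.prod • v ∈ Z i := by
    intro i j w
    induction w with
    | singleton x hx => intro v hv; simpa [ev] using hstep _ x hx v hv
    | append w₁ hne w₂ h₁ h₂ =>
      intro v hv
      rw [Monoid.CoprodI.NeWord.append_prod, map_mul, mul_smul]
      exact h₁ _ (Or.inr ⟨_, hne, h₂ v hv⟩)
  have hne : Monoid.CoprodI.Word.equiv (toI g) ≠ Monoid.CoprodI.Word.empty := by
    intro h
    apply hg
    have h1 : toI g = 1 := by
      rw [← Monoid.CoprodI.Word.equiv.symm_apply_apply (toI g), h]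
      exact Monoid.CoprodI.Word.prod_empty
    simpa [h1] using (DFunLike.congr_fun hof g).symm
  obtain ⟨i, j, w, hw⟩ := Monoid.CoprodI.NeWord.of_word _ hne
  have hprod : w.prod = toI g := by
    rw [Monoid.CoprodI.NeWord.prod, hw]
    exact Monoid.CoprodI.Word.equiv.symm_apply_apply (toI g)
  have hmem := hword i j w u (Or.inl hu)
  rw [hprod, ← MonoidHom.comp_apply, hev] at hmem
  intro hU
  cases i
  · exact Set.disjoint_left.1 hYU hmem hU
  · exact Set.disjoint_left.1 hXU hmem hU

/-- The homomorphism from a cyclic group that sends the generator `a` to `b`. -/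
theorem exists_zpowers_hom {G G' : Type*} [Group G] [Group G'] {a : G} {b : G'}
    (h : orderOf b ∣ orderOf a) :
    ∃ φ : Subgroup.zpowers a →* G', φ ⟨a, Subgroup.mem_zpowers a⟩ = b := by
  have hsurj := (zpowersHom G a).rangeRestrict_surjective
  -- Every relation a ^ n = 1 holds for b, so n ↦ b ^ n descends to the cyclic group of a.
  have hker : (zpowersHom G a).rangeRestrict.ker ≤ (zpowersHom G' b).ker := by
    intro n hn
    rw [MonoidHom.ker_rangeRestrict, MonoidHom.mem_ker, zpowersHom_apply,
      ← orderOf_dvd_iff_zpow_eq_one] at hn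
    rw [MonoidHom.mem_ker, zpowersHom_apply, ← orderOf_dvd_iff_zpow_eq_one]
    exact (Int.natCast_dvd_natCast.2 h).trans hn
  refine ⟨(zpowersHom G a).rangeRestrict.liftOfSurjective hsurj ⟨zpowersHom G' b, hker⟩, ?_⟩
  have := (zpowersHom G a).rangeRestrict.liftOfRightInverse_comp_apply _
    (Function.rightInverse_surjInv hsurj) ⟨zpowersHom G' b, hker⟩ (Multiplicative.ofAdd 1)
  simp only [zpowersHom_apply, toAdd_ofAdd, zpow_one] at this
  have e : (zpowersHom G a).rangeRestrict (Multiplicative.ofAdd 1)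
      = ⟨a, Subgroup.mem_zpowers a⟩ := Subtype.ext (by simp)
  rw [e] at this
  exact this

/-- A relation between free generators also holds between two elements whose orders divide those of
the generators. -/
theorem FreelyGenerate.lift_eq_one {G G' : Type*} [Group G] [Group G'] {a b : G} {a' b' : G'}
    (h : FreelyGenerate a b) (ha : orderOf a' ∣ orderOf a) (hb : orderOf b' ∣ orderOf b)
    {w : FreeGroup Bool} (hw : FreeGroup.lift (fun i => bif i then a else b) w = 1) :
    FreeGroup.lift (fun i => bif i then a' else b') w = 1 := by
  obtain ⟨φ, hφ⟩ := exists_zpowers_hom ha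
  obtain ⟨ψ, hψ⟩ := exists_zpowers_hom hb
  let σ : FreeGroup Bool →* Monoid.Coprod (Subgroup.zpowers a) (Subgroup.zpowers b) :=
    FreeGroup.lift (fun i => bif i then Monoid.Coprod.inl ⟨a, Subgroup.mem_zpowers a⟩
      else Monoid.Coprod.inr ⟨b, Subgroup.mem_zpowers b⟩)
  have h₁ : (Monoid.Coprod.lift (Subgroup.zpowers a).subtype (Subgroup.zpowers b).subtype).comp σ
      = FreeGroup.lift (fun i => bif i then a else b) := by
    ext (_ | _) <;> simp [σ]
  have h₂ : (Monoid.Coprod.lift φ ψ).comp σ = FreeGroup.lift (fun i => bif i then a' else b') := by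
    ext (_ | _) <;> simp [σ, hφ, hψ]
  have hσ : σ w = 1 := by
    apply h
    rw [map_one, ← MonoidHom.comp_apply, h₁, hw]
  rw [← h₂, MonoidHom.comp_apply, hσ, map_one]

/-! ### Sectors and half-planes -/

/-- The open sector `|arg w| < θ` (for `0 < θ < π / 2`). -/
def openSector (θ : ℝ) : Set ℂ := {w | 0 < (w * exp (θ * I)).im ∧ (w * exp (-(θ * I))).im < 0}

/-- The closed sector `|arg w| ≤ θ` (for `0 < θ < π / 2`), with the vertex. -/
def closedSector (θ : ℝ) : Set ℂ := {w | 0 ≤ (w * exp (θ * I)).im ∧ (w * exp (-(θ * I))).im ≤ 0}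

theorem im_mul_exp (w : ℂ) (t : ℝ) : (w * exp (t * I)).im = ‖w‖ * Real.sin (arg w + t) := by
  nth_rw 1 [← norm_mul_exp_arg_mul_I w]
  rw [mul_assoc, ← exp_add, ← add_mul, ← ofReal_add, im_ofReal_mul, exp_ofReal_mul_I_im]

theorem im_mul_exp_neg (w : ℂ) (t : ℝ) :
    (w * exp (-(t * I))).im = ‖w‖ * Real.sin (arg w - t) := by
  have := im_mul_exp w (-t)
  rwa [ofReal_neg, neg_mul, ← sub_eq_add_neg] at this

theorem ne_zero_of_mem_openSector {θ : ℝ} {w : ℂ} (h : w ∈ openSector θ) : w ≠ 0 := by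
  rintro rfl
  simpa using h.1

theorem abs_arg_lt_of_mem_openSector {θ : ℝ} (h₀ : 0 < θ) {w : ℂ}
    (h : w ∈ openSector θ) : |arg w| < θ := by
  have hw : 0 < ‖w‖ := norm_pos_iff.2 (ne_zero_of_mem_openSector h)
  obtain ⟨ha, hb⟩ := h
  rw [im_mul_exp] at ha
  rw [im_mul_exp_neg] at hb
  replace ha := pos_of_mul_pos_right ha hw.le
  replace hb : Real.sin (arg w - θ) < 0 := by
    by_contra! hc
    exact absurd hb (not_lt.2 (mul_nonneg hw.le hc))
  have h1 := neg_pi_lt_arg w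
  have h2 := arg_le_pi w
  rw [abs_lt]
  constructor
  · by_contra! hc
    exact absurd ha (not_lt.2 (Real.sin_nonpos_of_nonpos_of_neg_pi_le (by linarith) (by linarith)))
  · by_contra! hc
    exact absurd hb (not_lt.2 (Real.sin_nonneg_of_nonneg_of_le_pi (by linarith) (by linarith)))

theorem abs_arg_le_of_mem_closedSector {θ : ℝ} (h₀ : 0 < θ) {w : ℂ}
    (hw₀ : w ≠ 0) (h : w ∈ closedSector θ) : |arg w| ≤ θ := by
  have hw : 0 < ‖w‖ := norm_pos_iff.2 hw₀
  obtain ⟨ha, hb⟩ := h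
  rw [im_mul_exp] at ha
  rw [im_mul_exp_neg] at hb
  replace ha := nonneg_of_mul_nonneg_right ha hw
  replace hb : Real.sin (arg w - θ) ≤ 0 := by
    by_contra! hc
    exact absurd hb (not_le.2 (mul_pos hw hc))
  have h1 := neg_pi_lt_arg w
  have h2 := arg_le_pi w
  rw [abs_le]
  constructor
  · by_contra! hc
    exact absurd ha (not_le.2 (Real.sin_neg_of_neg_of_neg_pi_lt (by linarith) (by linarith)))
  · by_contra! hc
    exact absurd hb (not_le.2 (Real.sin_pos_of_pos_of_lt_pi (by linarith) (by linarith)))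

/-- A rotation by a multiple of the angle `2π / p` of a sector of this angle is trivial if it does
not move the sector off itself. -/
theorem dvd_of_mem_sector {p : ℕ} (hp : 3 ≤ p) {w : ℂ} (hw : w ∈ openSector (Real.pi / p)) {k : ℤ}
    (hk : exp ((Real.pi / p : ℝ) * I) ^ (2 * k) * w ∈ closedSector (Real.pi / p)) :
    (p : ℤ) ∣ k := by
  have hp' : (3 : ℝ) ≤ p := by exact_mod_cast hp
  have hπ := Real.pi_pos
  have h₀ : 0 < Real.pi / p := by positivity
  have hw0 := ne_zero_of_mem_openSector hw
  set z := exp ((Real.pi / p : ℝ) * I) ^ (2 * k) * w with hz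
  have hz0 : z ≠ 0 := mul_ne_zero (zpow_ne_zero _ (exp_ne_zero _)) hw0
  have ha := abs_lt.1 (abs_arg_lt_of_mem_openSector h₀ hw)
  have hb := abs_le.1 (abs_arg_le_of_mem_closedSector h₀ hz0 hk)
  have hnorm : ‖z‖ = ‖w‖ := by
    rw [hz, norm_mul, norm_zpow, norm_exp_ofReal_mul_I, one_zpow, one_mul]
  have key : exp ((arg z : ℂ) * I) = exp (((2 * k : ℤ) * (Real.pi / p : ℝ) + arg w : ℂ) * I) := by
    have h1 := norm_mul_exp_arg_mul_I z
    have h2 := norm_mul_exp_arg_mul_I w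
    have hne : (‖w‖ : ℂ) ≠ 0 := by simpa using hw0
    apply mul_left_cancel₀ hne
    rw [add_mul, exp_add, mul_assoc, exp_int_mul, mul_left_comm, h2, ← hnorm, h1, hz]
  obtain ⟨m, hm⟩ := exp_eq_exp_iff_exists_int.1 key
  have hm' : arg z = 2 * k * (Real.pi / p) + arg w + m * (2 * Real.pi) := by
    have : ((arg z : ℝ) : ℂ) * I
        = ((2 * k * (Real.pi / p) + arg w + m * (2 * Real.pi) : ℝ) : ℂ) * I := by
      rw [hm]; push_cast; ring
    exact_mod_cast mul_right_cancel₀ I_ne_zero this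
  have hpp : (p : ℝ) * (Real.pi / p) = Real.pi := by field_simp
  have hfac : arg z - arg w = 2 * (Real.pi / p) * ((k + m * p : ℤ) : ℝ) := by
    rw [hm']; push_cast; linear_combination (- 2 * (m : ℝ)) * hpp
  -- One argument lies in an open interval of length 2π/p and the other in its closure, while their
  -- difference is an integer multiple of 2π/p.
  have hlt : |((k + m * p : ℤ) : ℝ)| < 1 := by
    have : |arg z - arg w| < 2 * (Real.pi / p) := by rw [abs_lt]; constructor <;> linarith
    rw [hfac, abs_mul, abs_of_pos (by positivity)] at this
    by_contra! hc
    nlinarith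
  have h0 : k + m * p = 0 := Int.abs_lt_one_iff.1 (by exact_mod_cast hlt)
  exact ⟨-m, by linarith⟩

/-- The positivity of a Hermitian form in two variables. -/
theorem hermitian_form_nonneg {P P' ρ : ℂ} {s : ℝ} (hs : 0 < s) (hP : ‖P‖ = 1) (hP' : ‖P'‖ = 1)
    (h₁ : P.re < 0) (h₂ : (P' * conj ρ).re < 0)
    (h : 1 + (P * conj P').re ≤ P.re * (P' * conj ρ).re / (2 * s ^ 2)) (x y : ℂ) :
    0 ≤ (P * ((x - I / (2 * s) * y) * conj y)).im
      + (P' * (x * conj (y - ρ / (2 * I * s) * x))).im := by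
  have hs' : (s : ℂ) ≠ 0 := by exact_mod_cast hs.ne'
  have e₁ : P * ((x - I / (2 * s) * y) * conj y)
      = P * (x * conj y) - ((‖y‖ ^ 2 / (2 * s) : ℝ) : ℂ) * (P * I) := by
    push_cast; rw [← mul_conj']; field_simp
  have e₂ : P' * (x * conj (y - ρ / (2 * I * s) * x))
      = P' * (x * conj y) - ((‖x‖ ^ 2 / (2 * s) : ℝ) : ℂ) * ((P' * conj ρ) * I) := by
    push_cast; rw [← mul_conj']; simp only [map_sub, map_mul, map_div₀, conj_I, conj_ofReal,
      map_ofNat]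
    field_simp
    ring_nf
    simp
  -- The sum is a Hermitian form with cross coefficient P + P' and diagonal coefficients a for |y|²
  -- and b for |x|². The hypothesis `h` says |P + P'|² ≤ 4ab, and the arithmetic-geometric mean
  -- inequality concludes.
  have e₃ : (P * ((x - I / (2 * s) * y) * conj y)).im
      + (P' * (x * conj (y - ρ / (2 * I * s) * x))).im
      = ((P + P') * (x * conj y)).im - ‖y‖ ^ 2 / (2 * s) * P.re
        - ‖x‖ ^ 2 / (2 * s) * (P' * conj ρ).re := by
    rw [e₁, e₂, sub_im, sub_im, im_ofReal_mul, im_ofReal_mul, mul_I_im, mul_I_im, add_mul, add_im]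
    ring
  rw [e₃]
  have hb : -(‖P + P'‖ * (‖x‖ * ‖y‖)) ≤ ((P + P') * (x * conj y)).im := by
    have := (abs_le.1 (abs_im_le_norm ((P + P') * (x * conj y)))).1
    simpa using this
  have hsq : ‖P + P'‖ ^ 2 = 2 * (1 + (P * conj P').re) := by
    rw [← normSq_eq_norm_sq, normSq_add, normSq_eq_norm_sq, normSq_eq_norm_sq, hP, hP']
    ring
  set a := -P.re / (2 * s) with ha
  set b := -(P' * conj ρ).re / (2 * s) with hbb
  have hapos : 0 < a := by rw [ha]; apply div_pos <;> linarith
  have hbpos : 0 < b := by rw [hbb]; apply div_pos <;> linarith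
  have hab : ‖P + P'‖ ^ 2 ≤ 4 * (a * b) := by
    have : 4 * (a * b) = 2 * (P.re * (P' * conj ρ).re / (2 * s ^ 2)) := by
      rw [ha, hbb]; field_simp; ring
    linarith
  have hle : ‖P + P'‖ * (‖x‖ * ‖y‖) ≤ a * ‖y‖ ^ 2 + b * ‖x‖ ^ 2 := by
    apply abs_le_of_sq_le_sq' _ (by positivity) |>.2
    have h4 : 4 * (a * b) * (‖x‖ * ‖y‖) ^ 2 ≤ (a * ‖y‖ ^ 2 + b * ‖x‖ ^ 2) ^ 2 := by
      nlinarith [sq_nonneg (a * ‖y‖ ^ 2 - b * ‖x‖ ^ 2)]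
    calc (‖P + P'‖ * (‖x‖ * ‖y‖)) ^ 2 = ‖P + P'‖ ^ 2 * (‖x‖ * ‖y‖) ^ 2 := by ring
      _ ≤ 4 * (a * b) * (‖x‖ * ‖y‖) ^ 2 := by gcongr
      _ ≤ _ := h4
  have : a * ‖y‖ ^ 2 + b * ‖x‖ ^ 2 = - (‖y‖ ^ 2 / (2 * s) * P.re)
      - ‖x‖ ^ 2 / (2 * s) * (P' * conj ρ).re := by rw [ha, hbb]; ring
  linarith

/-! ### Elements of finite order in PSL(2, ℂ) -/

abbrev SL2C : Type := Matrix.SpecialLinearGroup (Fin 2) ℂ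

theorem toPSL_eq_toPSL_iff {M N : SL2C} :
    toPSL M = toPSL N ↔ ∃ r : ℂ, r ^ 2 = 1 ∧ (N : Matrix (Fin 2) (Fin 2) ℂ) = r • M.1 := by
  rw [toPSL, QuotientGroup.mk'_eq_mk']
  constructor
  · rintro ⟨z, hz, rfl⟩
    obtain ⟨r, hr, hrz⟩ := Matrix.SpecialLinearGroup.mem_center_iff.1 hz
    refine ⟨r, by simpa using hr, ?_⟩
    rw [Matrix.SpecialLinearGroup.coe_mul, ← hrz, Matrix.scalar_apply,
      Matrix.smul_eq_mul_diagonal]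
  · rintro ⟨r, hr, h⟩
    refine ⟨M⁻¹ * N, Matrix.SpecialLinearGroup.mem_center_iff.2 ⟨r, by simpa using hr, ?_⟩,
      mul_inv_cancel_left _ _⟩
    rw [Matrix.SpecialLinearGroup.coe_mul, h, Matrix.mul_smul, ← Matrix.SpecialLinearGroup.coe_mul,
      inv_mul_cancel, Matrix.scalar_apply, Matrix.SpecialLinearGroup.coe_one, Matrix.smul_one_eq_diagonal]

theorem toPSL_eq_one_iff {M : SL2C} :
    toPSL M = 1 ↔ ∃ r : ℂ, r ^ 2 = 1 ∧ M.1 = r • (1 : Matrix (Fin 2) (Fin 2) ℂ) := by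
  rw [eq_comm, ← map_one toPSL, toPSL_eq_toPSL_iff, Matrix.SpecialLinearGroup.coe_one]

/-- A matrix with eigenvalues `u ≠ u⁻¹` such that `u ^ N = u ^ (-N) = ε` has `N`-th power `ε`. -/
theorem pow_eq_smul_one_of_trace {M : SL2C} {u ε : ℂ} (hu : u ≠ 0) (hne : u ≠ u⁻¹) {N : ℕ}
    (h₁ : u ^ N = ε) (h₂ : u⁻¹ ^ N = ε) (htr : M.1.trace = u + u⁻¹) :
    M.1 ^ N = ε • (1 : Matrix (Fin 2) (Fin 2) ℂ) := by
  open Polynomial in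
  -- As u ≠ u⁻¹, the characteristic polynomial divides X ^ N - ε; the Cayley–Hamilton theorem then
  -- applies.
  have hd : (X - C u) * (X - C u⁻¹) ∣ (X ^ N - C ε : ℂ[X]) := by
    refine IsCoprime.mul_dvd ?_ (dvd_iff_isRoot.2 (by simp [h₁])) (dvd_iff_isRoot.2 (by simp [← h₂]))
    exact isCoprime_X_sub_C_of_isUnit_sub (sub_ne_zero.2 hne).isUnit
  obtain ⟨q, hq⟩ := hd
  have hch : M.1.charpoly = (Polynomial.X - Polynomial.C u) * (Polynomial.X - Polynomial.C u⁻¹) := by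
    rw [Matrix.charpoly_fin_two, htr, M.2, map_add, map_one]
    have : Polynomial.C u * Polynomial.C u⁻¹ = (1 : Polynomial ℂ) := by
      rw [← map_mul, mul_inv_cancel₀ hu, map_one]
    linear_combination -this
  have := congrArg (Polynomial.aeval M.1) hq
  rw [← hch, map_mul, Matrix.aeval_self_charpoly, zero_mul, map_sub, map_pow, Polynomial.aeval_X,
    Polynomial.aeval_C, sub_eq_zero] at this
  rw [this, Algebra.algebraMap_eq_smul_one]

theorem expRoot_val (p : ℕ) : (expRoot p : ℂ) = exp ((Real.pi / p : ℝ) * I) := by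
  rw [expRoot, Units.val_mk0]
  congr 1
  push_cast
  ring

theorem expRoot_inv (p : ℕ) : (expRoot p : ℂ)⁻¹ = exp (-((Real.pi / p : ℝ) * I)) := by
  rw [expRoot_val, exp_neg]

theorem conj_expRoot (p : ℕ) : conj (expRoot p : ℂ) = (expRoot p : ℂ)⁻¹ := by
  rw [expRoot_inv, expRoot_val, ← exp_conj]
  simp

theorem expRoot_eq (p : ℕ) :
    (expRoot p : ℂ) = (Real.cos (Real.pi / p) : ℂ) + (Real.sin (Real.pi / p) : ℂ) * I := by
  rw [expRoot_val, exp_mul_I, ofReal_cos, ofReal_sin]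

theorem expRoot_inv_eq (p : ℕ) :
    (expRoot p : ℂ)⁻¹ = (Real.cos (Real.pi / p) : ℂ) - (Real.sin (Real.pi / p) : ℂ) * I := by
  rw [← conj_expRoot, expRoot_eq]
  simp [sub_eq_add_neg, -ofReal_cos, -ofReal_sin]

theorem sin_pi_div_pos {p : ℕ} (hp : 3 ≤ p) : 0 < Real.sin (Real.pi / p) := by
  have hp' : (3 : ℝ) ≤ p := by exact_mod_cast hp
  have hπ := Real.pi_pos
  exact Real.sin_pos_of_pos_of_lt_pi (by positivity) (div_lt_self hπ (by linarith))

theorem cos_pi_div_pos {p : ℕ} (hp : 3 ≤ p) : 0 < Real.cos (Real.pi / p) := by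
  have hp' : (3 : ℝ) ≤ p := by exact_mod_cast hp
  have hπ := Real.pi_pos
  have h₁ : Real.pi / p < Real.pi / 2 := by gcongr; linarith
  have h₂ : 0 < Real.pi / p := by positivity
  exact Real.cos_pos_of_mem_Ioo ⟨by linarith, h₁⟩

theorem expRoot_ne_inv {p : ℕ} (hp : 3 ≤ p) : (expRoot p : ℂ) ≠ (expRoot p : ℂ)⁻¹ := by
  intro h
  rw [expRoot_inv_eq, expRoot_eq] at h
  have := congrArg im h
  simp [-ofReal_cos, -ofReal_sin] at this
  linarith [sin_pi_div_pos hp]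

theorem expRoot_pow {p : ℕ} (hp : 3 ≤ p) : (expRoot p : ℂ) ^ p = -1 := by
  rw [expRoot_val, ← exp_nat_mul, ← exp_pi_mul_I]
  congr 1
  push_cast
  have : (p : ℂ) ≠ 0 := by exact_mod_cast (by omega : p ≠ 0)
  field_simp

/-- Since α ^ p = -1, the p-th power of the matrix is -1, which becomes trivial only in PSL(2, ℂ).
-/
theorem toPSL_pow_eq_one {p : ℕ} (hp : 3 ≤ p) {M : SL2C}
    (hM : M.1.trace = (expRoot p : ℂ) + (expRoot p : ℂ)⁻¹) : toPSL M ^ p = 1 := by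
  rw [← map_pow, toPSL_eq_one_iff]
  refine ⟨-1, by norm_num, ?_⟩
  rw [Matrix.SpecialLinearGroup.coe_pow]
  exact pow_eq_smul_one_of_trace (expRoot p).ne_zero (expRoot_ne_inv hp) (expRoot_pow hp)
    (by rw [inv_pow, expRoot_pow hp]; norm_num) hM

theorem trace_genA (α : ℂˣ) : (genA α).1.trace = (α : ℂ) + (α : ℂ)⁻¹ := by
  simp [genA, Matrix.trace_fin_two]

theorem trace_genB (β : ℂˣ) (ρ : ℂ) : (genB β ρ).1.trace = (β : ℂ) + (β : ℂ)⁻¹ := by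
  simp [genB, Matrix.trace_fin_two]

/-! ### Rotation coordinates on PSL(2, ℂ) and the ping-pong criterion -/

/-- A function of the first column `v` of a matrix of `SL(2, ℂ)`, viewed as a function on
`PSL(2, ℂ)`, which makes sense if it is invariant under the change of the sign of `v`. -/
noncomputable def columnFun (F : ℂ → ℂ → ℂ) (g : PSL2C) : ℂ := F (g.out 0 0) (g.out 1 0)

theorem columnFun_toPSL {F : ℂ → ℂ → ℂ} (hF : ∀ r x y, r ^ 2 = 1 → F (r * x) (r * y) = F x y)
    (M : SL2C) : columnFun F (toPSL M) = F (M 0 0) (M 1 0) := by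
  have h : toPSL (toPSL M).out = toPSL M := QuotientGroup.out_eq' _
  obtain ⟨r, hr, h'⟩ := toPSL_eq_toPSL_iff.1 h
  rw [columnFun, ← hF r _ _ hr]
  have h0 := congrFun (congrFun h' 0) 0
  have h1 := congrFun (congrFun h' 1) 0
  simp only [Matrix.smul_apply, smul_eq_mul] at h0 h1
  rw [h0, h1]

theorem continuous_columnFun {F : ℂ → ℂ → ℂ}
    (hF : ∀ r x y, r ^ 2 = 1 → F (r * x) (r * y) = F x y)
    (hc : Continuous fun v : ℂ × ℂ => F v.1 v.2) : Continuous (columnFun F) := by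
  have hq : Topology.IsQuotientMap (toPSL : SL2C → PSL2C) := QuotientGroup.isQuotientMap_mk _
  rw [hq.continuous_iff]
  have : columnFun F ∘ toPSL = fun M : SL2C => F (M.1 0 0) (M.1 1 0) :=
    funext (columnFun_toPSL hF)
  rw [this]
  have hcoe : Continuous (fun M : SL2C => M.1) := continuous_subtype_val
  exact hc.comp ((hcoe.matrix_elem 0 0).prodMk (hcoe.matrix_elem 1 0))

theorem columnFun_mul {F : ℂ → ℂ → ℂ} (hF : ∀ r x y, r ^ 2 = 1 → F (r * x) (r * y) = F x y)
    {M : SL2C} {q : ℂ}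
    (h : ∀ x y, F (M 0 0 * x + M 0 1 * y) (M 1 0 * x + M 1 1 * y) = q * F x y) (g : PSL2C) :
    columnFun F (toPSL M * g) = q * columnFun F g := by
  obtain ⟨N, rfl⟩ := QuotientGroup.mk'_surjective _ g
  change columnFun F (toPSL M * toPSL N) = q * columnFun F (toPSL N)
  rw [← map_mul, columnFun_toPSL hF, columnFun_toPSL hF, ← h]
  simp [Matrix.mul_apply]

theorem columnFun_zpow_mul {F : ℂ → ℂ → ℂ} (hF : ∀ r x y, r ^ 2 = 1 → F (r * x) (r * y) = F x y)
    {M : SL2C} {q : ℂ} (hq : q ≠ 0)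
    (h : ∀ x y, F (M 0 0 * x + M 0 1 * y) (M 1 0 * x + M 1 1 * y) = q * F x y) (k : ℤ) (g : PSL2C) :
    columnFun F (toPSL M ^ k * g) = q ^ k * columnFun F g := by
  induction k generalizing g with
  | zero => simp
  | succ k ih => rw [zpow_add_one, zpow_add_one₀ hq, mul_assoc, ih, columnFun_mul hF h, mul_assoc]
  | pred k ih =>
    have := columnFun_mul hF h ((toPSL M)⁻¹ * g)
    rw [mul_inv_cancel_left] at this
    rw [zpow_sub_one, zpow_sub_one₀ hq, mul_assoc, ih, this]
    field_simp

/-- The pair of unit complex numbers normal to the two sides of a sector of axis `n⁻¹`. -/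
def sideNormals (p : ℕ) (n : ℂ) : Set ℂ := {n * (expRoot p : ℂ), -(n * (expRoot p : ℂ)⁻¹)}

/-- The inequality which says that the disk of the normal `P'` lies in the half-plane of the
normal `P`. -/
def DiskInHalfPlane (p : ℕ) (ρ P P' : ℂ) : Prop :=
  P.re < 0 ∧ (P' * conj ρ).re < 0 ∧
    1 + (P * conj P').re ≤ P.re * (P' * conj ρ).re / (2 * Real.sin (Real.pi / p) ^ 2)

/-- The exterior of a fundamental domain of `⟨B_ρ⟩` (a lune of direction `n'`) lies in a
fundamental domain of `⟨A⟩` (a sector of direction `n`). -/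
structure PingPong (p : ℕ) (n n' ρ : ℂ) : Prop where
  norm_left : ‖n‖ = 1
  norm_right : ‖n'‖ = 1
  diskInHalfPlane : ∀ P ∈ sideNormals p n, ∀ P' ∈ sideNormals p n', DiskInHalfPlane p ρ P P'

/-- The coordinate in which `A` is a rotation. -/
noncomputable def rotA (p : ℕ) (n x y : ℂ) : ℂ :=
  n * ((x - I / (2 * (Real.sin (Real.pi / p) : ℝ)) * y) * conj y)

/-- The coordinate in which `B_ρ` is a rotation. -/
noncomputable def rotB (p : ℕ) (n ρ x y : ℂ) : ℂ :=
  n * (x * conj (y - ρ / (2 * I * (Real.sin (Real.pi / p) : ℝ)) * x))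

theorem mul_conj_of_sq_eq_one {r : ℂ} (hr : r ^ 2 = 1) : r * conj r = 1 := by
  rcases (sq_eq_sq_iff_eq_or_eq_neg.1 (hr.trans (one_pow 2).symm)) with rfl | rfl <;> simp

theorem rotA_smul (p : ℕ) (n : ℂ) (r x y : ℂ) (hr : r ^ 2 = 1) :
    rotA p n (r * x) (r * y) = rotA p n x y := by
  have := mul_conj_of_sq_eq_one hr
  simp only [rotA, map_mul]
  linear_combination (n * ((x - I / (2 * (Real.sin (Real.pi / p) : ℝ)) * y) * conj y)) * this

theorem rotB_smul (p : ℕ) (n ρ : ℂ) (r x y : ℂ) (hr : r ^ 2 = 1) :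
    rotB p n ρ (r * x) (r * y) = rotB p n ρ x y := by
  have := mul_conj_of_sq_eq_one hr
  simp only [rotB, map_mul, map_sub]
  linear_combination (n * (x * (conj y - conj (ρ / (2 * I * (Real.sin (Real.pi / p) : ℝ)))
    * conj x))) * this

theorem continuous_rotA (p : ℕ) (n : ℂ) : Continuous fun v : ℂ × ℂ => rotA p n v.1 v.2 := by
  unfold rotA
  fun_prop

theorem continuous_rotB (p : ℕ) (n ρ : ℂ) : Continuous fun v : ℂ × ℂ => rotB p n ρ v.1 v.2 := by
  unfold rotB
  fun_prop

/-- As α - α⁻¹ = 2is, the finite fixed point of A is i/(2s). At z = x/y the coordinate is n(z -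
i/(2s)) up to the factor |y|², which A preserves. -/
theorem rotA_genA {p : ℕ} (hp : 3 ≤ p) (n x y : ℂ) :
    rotA p n (genA (expRoot p) 0 0 * x + genA (expRoot p) 0 1 * y)
      (genA (expRoot p) 1 0 * x + genA (expRoot p) 1 1 * y)
      = (expRoot p : ℂ) ^ 2 * rotA p n x y := by
  have hs : ((Real.sin (Real.pi / p) : ℝ) : ℂ) ≠ 0 := by exact_mod_cast (sin_pi_div_pos hp).ne'
  have h1 : (expRoot p : ℂ) * (expRoot p : ℂ)⁻¹ = 1 := mul_inv_cancel₀ (expRoot p).ne_zero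
  have h2 : (expRoot p : ℂ) - (expRoot p : ℂ)⁻¹ = 2 * I * (Real.sin (Real.pi / p) : ℝ) := by
    rw [expRoot_inv_eq, expRoot_eq]; ring
  have hc := conj_expRoot p
  have hc' : conj (expRoot p : ℂ)⁻¹ = (expRoot p : ℂ) := by rw [map_inv₀, hc, inv_inv]
  have hz : ∀ S : ℂ, S ≠ 0 → (expRoot p : ℂ) - (expRoot p : ℂ)⁻¹ = 2 * I * S →
      1 - I / (2 * S) * (expRoot p : ℂ)⁻¹ = - (I / (2 * S)) * (expRoot p : ℂ) := by
    intro S hS h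
    have : I / (2 * S) * ((expRoot p : ℂ) - (expRoot p : ℂ)⁻¹) = -1 := by
      rw [h]; field_simp; rw [I_sq]
    linear_combination this
  have hz' := hz _ hs h2
  have e : ∀ i j, genA (expRoot p) i j
      = (!![(expRoot p : ℂ), 1; 0, (expRoot p : ℂ)⁻¹] : Matrix (Fin 2) (Fin 2) ℂ) i j :=
    fun i j => rfl
  simp only [e, rotA, Matrix.of_apply, Matrix.cons_val', Matrix.cons_val_zero, Matrix.cons_val_one,
    zero_mul, zero_add, one_mul, map_mul, hc', Matrix.cons_val_fin_one]
  linear_combination (n * y * conj y * (expRoot p : ℂ)) * hz'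

/-- The linear forms x and y - ρx/(2is) are scaled by β and β⁻¹; conjugating the second turns β⁻¹
into β, so the product is scaled by β². -/
theorem rotB_genB {p : ℕ} (hp : 3 ≤ p) (n ρ x y : ℂ) :
    rotB p n ρ (genB (expRoot p) ρ 0 0 * x + genB (expRoot p) ρ 0 1 * y)
      (genB (expRoot p) ρ 1 0 * x + genB (expRoot p) ρ 1 1 * y)
      = (expRoot p : ℂ) ^ 2 * rotB p n ρ x y := by
  have hs : ((Real.sin (Real.pi / p) : ℝ) : ℂ) ≠ 0 := by exact_mod_cast (sin_pi_div_pos hp).ne'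
  have h2 : (expRoot p : ℂ) - (expRoot p : ℂ)⁻¹ = 2 * I * (Real.sin (Real.pi / p) : ℝ) := by
    rw [expRoot_inv_eq, expRoot_eq]; ring
  have hc := conj_expRoot p
  have hc' : conj (expRoot p : ℂ)⁻¹ = (expRoot p : ℂ) := by rw [map_inv₀, hc, inv_inv]
  have hm : ρ - ρ / (2 * I * (Real.sin (Real.pi / p) : ℝ)) * (expRoot p : ℂ)
      = - (ρ / (2 * I * (Real.sin (Real.pi / p) : ℝ))) * (expRoot p : ℂ)⁻¹ := by
    have : ρ / (2 * I * (Real.sin (Real.pi / p) : ℝ)) * ((expRoot p : ℂ) - (expRoot p : ℂ)⁻¹)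
        = ρ := by
      rw [h2]; exact div_mul_cancel₀ _ (mul_ne_zero (mul_ne_zero two_ne_zero I_ne_zero) hs)
    linear_combination -this
  have e : ∀ i j, genB (expRoot p) ρ i j
      = (!![(expRoot p : ℂ), 0; ρ, (expRoot p : ℂ)⁻¹] : Matrix (Fin 2) (Fin 2) ℂ) i j :=
    fun i j => rfl
  have hy : ρ * x + (expRoot p : ℂ)⁻¹ * y
      - ρ / (2 * I * (Real.sin (Real.pi / p) : ℝ)) * ((expRoot p : ℂ) * x)
      = (expRoot p : ℂ)⁻¹ * (y - ρ / (2 * I * (Real.sin (Real.pi / p) : ℝ)) * x) := by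
    linear_combination x * hm
  simp only [e, rotB, Matrix.of_apply, Matrix.cons_val', Matrix.cons_val_zero, Matrix.cons_val_one,
    zero_mul, add_zero, Matrix.cons_val_fin_one]
  rw [hy, map_mul, hc']
  ring

theorem mem_openSector_iff {p : ℕ} {w : ℂ} : w ∈ openSector (Real.pi / p) ↔
    0 < (w * (expRoot p : ℂ)).im ∧ 0 < (-(w * (expRoot p : ℂ)⁻¹)).im := by
  rw [openSector, Set.mem_ofPred_eq, ← expRoot_val, ← expRoot_inv, neg_im, neg_pos]

theorem mem_closedSector_iff {p : ℕ} {w : ℂ} : w ∈ closedSector (Real.pi / p) ↔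
    0 ≤ (w * (expRoot p : ℂ)).im ∧ 0 ≤ (-(w * (expRoot p : ℂ)⁻¹)).im := by
  rw [closedSector, Set.mem_ofPred_eq, ← expRoot_val, ← expRoot_inv, neg_im, neg_nonneg]

theorem openSector_subset_closedSector (θ : ℝ) : openSector θ ⊆ closedSector θ :=
  fun _ h => ⟨h.1.le, h.2.le⟩

theorem isOpen_openSector (θ : ℝ) : IsOpen (openSector θ) := by
  have hc (z : ℂ) : Continuous fun w : ℂ => (w * z).im := by fun_prop
  exact (isOpen_lt continuous_const (hc _)).inter (isOpen_lt (hc _) continuous_const)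

theorem mul_mem_openSector {θ r : ℝ} (hr : 0 < r) {w : ℂ} (hw : w ∈ openSector θ) :
    (r : ℂ) * w ∈ openSector θ := by
  refine ⟨?_, ?_⟩
  · rw [mul_assoc, im_ofReal_mul]; exact mul_pos hr hw.1
  · rw [mul_assoc, im_ofReal_mul]; exact mul_neg_of_pos_of_neg hr hw.2

theorem one_mem_openSector {p : ℕ} (hp : 3 ≤ p) : (1 : ℂ) ∈ openSector (Real.pi / p) := by
  rw [mem_openSector_iff, one_mul, one_mul, expRoot_inv_eq, expRoot_eq]
  simpa [-ofReal_cos, -ofReal_sin] using sin_pi_div_pos hp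

theorem norm_expRoot (p : ℕ) : ‖(expRoot p : ℂ)‖ = 1 := by
  rw [expRoot_val, norm_exp_ofReal_mul_I]

theorem norm_of_mem_sideNormals {p : ℕ} {n P : ℂ} (hn : ‖n‖ = 1) (hP : P ∈ sideNormals p n) :
    ‖P‖ = 1 := by
  rcases hP with rfl | rfl <;> simp [hn, norm_expRoot]

namespace PingPong

variable {p : ℕ} {n n' ρ : ℂ}

theorem im_add_im_nonneg (h : PingPong p n n' ρ) (hp : 3 ≤ p) (x y : ℂ) {u u' : ℂ}
    (hu : n * u ∈ sideNormals p n) (hu' : n' * u' ∈ sideNormals p n') :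
    0 ≤ (rotA p n x y * u).im + (rotB p n' ρ x y * u').im := by
  obtain ⟨h₁, h₂, h₃⟩ := h.diskInHalfPlane _ hu _ hu'
  have := hermitian_form_nonneg (sin_pi_div_pos hp) (norm_of_mem_sideNormals h.norm_left hu)
    (norm_of_mem_sideNormals h.norm_right hu') h₁ h₂ h₃ x y
  rwa [mul_right_comm n, mul_right_comm n'] at this

theorem mem_sideNormals₁ : n * (expRoot p : ℂ) ∈ sideNormals p n := Or.inl rfl

theorem mem_sideNormals₂ : n * -(expRoot p : ℂ)⁻¹ ∈ sideNormals p n := Or.inr (mul_neg _ _)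

/-- Each side form of the sector plus each side form of the lune is nonnegative. One negative side
form of the lune thus makes both side forms of the sector positive. -/
theorem rotA_mem (h : PingPong p n n' ρ) (hp : 3 ≤ p) {x y : ℂ}
    (hxy : rotB p n' ρ x y ∉ closedSector (Real.pi / p)) :
    rotA p n x y ∈ openSector (Real.pi / p) := by
  have h₁₁ := h.im_add_im_nonneg hp x y mem_sideNormals₁ mem_sideNormals₁
  have h₁₂ := h.im_add_im_nonneg hp x y mem_sideNormals₁ mem_sideNormals₂
  have h₂₁ := h.im_add_im_nonneg hp x y mem_sideNormals₂ mem_sideNormals₁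
  have h₂₂ := h.im_add_im_nonneg hp x y mem_sideNormals₂ mem_sideNormals₂
  rw [mem_closedSector_iff, not_and_or, not_le, not_le, ← mul_neg] at hxy
  rw [mem_openSector_iff, ← mul_neg]
  rcases hxy with hxy | hxy <;> constructor <;> linarith

theorem rotB_mem (h : PingPong p n n' ρ) (hp : 3 ≤ p) {x y : ℂ}
    (hxy : rotA p n x y ∉ closedSector (Real.pi / p)) :
    rotB p n' ρ x y ∈ openSector (Real.pi / p) := by
  have h₁₁ := h.im_add_im_nonneg hp x y mem_sideNormals₁ mem_sideNormals₁
  have h₁₂ := h.im_add_im_nonneg hp x y mem_sideNormals₁ mem_sideNormals₂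
  have h₂₁ := h.im_add_im_nonneg hp x y mem_sideNormals₂ mem_sideNormals₁
  have h₂₂ := h.im_add_im_nonneg hp x y mem_sideNormals₂ mem_sideNormals₂
  rw [mem_closedSector_iff, not_and_or, not_le, not_le, ← mul_neg] at hxy
  rw [mem_openSector_iff, ← mul_neg]
  rcases hxy with hxy | hxy <;> constructor <;> linarith

/-- Take z = 1/(εn) near ∞ with ε > 0 small. Then `rotA` divided by ε tends to 1, on the axis of the
sector, and `rotB` tends to -n' times the conjugate of ρ/(2is), which the conditions Re(P' ρ̄) < 0
place in the open sector. -/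
theorem exists_mem (h : PingPong p n n' ρ) (hp : 3 ≤ p) :
    ∃ M : SL2C, rotA p n (M 0 0) (M 1 0) ∈ openSector (Real.pi / p) ∧
      rotB p n' ρ (M 0 0) (M 1 0) ∈ openSector (Real.pi / p) := by
  have hs := sin_pi_div_pos hp
  set s := Real.sin (Real.pi / p) with hsdef
  have hone := one_mem_openSector hp
  have hlim : n' * conj (0 * n - ρ / (2 * I * (s : ℝ))) ∈ openSector (Real.pi / p) := by
    have hne : (s : ℂ) ≠ 0 := by exact_mod_cast hs.ne'
    have e : ∀ u, (n' * conj (0 * n - ρ / (2 * I * (s : ℝ))) * u)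
        = ((2 * s)⁻¹ : ℝ) * (-(n' * u * conj ρ) * I) := by
      intro u
      simp only [map_sub, map_mul, map_div₀, conj_I, conj_ofReal, map_ofNat, map_zero]
      push_cast
      field_simp
      rw [I_sq]; ring
    have h1 := (h.diskInHalfPlane _ (Or.inl rfl) _ (Or.inl rfl)).2.1
    have h2 := (h.diskInHalfPlane _ (Or.inl rfl) _ (Or.inr rfl)).2.1
    rw [mem_openSector_iff, neg_im, e, e, im_ofReal_mul, im_ofReal_mul, mul_I_im, mul_I_im]
    have hpos : 0 < (2 * s)⁻¹ := by positivity
    constructor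
    · rw [neg_re]
      exact mul_pos hpos (neg_pos.2 h1)
    · rw [← mul_neg]
      refine mul_pos hpos ?_
      rw [← neg_re, neg_neg]
      rw [neg_mul, neg_re] at h2
      linarith
  have c1 : ContinuousAt (fun ε : ℝ => (1 - I / (2 * (s : ℝ)) * ((ε : ℂ) * n))) 0 := by fun_prop
  have c2 : ContinuousAt (fun ε : ℝ => n' * conj ((ε : ℂ) * n - ρ / (2 * I * (s : ℝ)))) 0 := by
    fun_prop
  have e1 := c1.eventually_mem ((isOpen_openSector _).mem_nhds (by simpa using hone))
  have e2 := c2.eventually_mem ((isOpen_openSector _).mem_nhds (by simpa using hlim))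
  obtain ⟨ε, ⟨h1, h2⟩, hε⟩ := (((e1.and e2).filter_mono nhdsWithin_le_nhds).and
    (self_mem_nhdsWithin : Set.Ioi (0 : ℝ) ∈ 𝓝[>] 0)).exists
  refine ⟨⟨!![1, 0; (ε : ℂ) * n, 1], by simp [Matrix.det_fin_two]⟩, ?_, ?_⟩
  · have hn : n * conj n = 1 := by rw [mul_conj', h.norm_left]; simp
    have : rotA p n 1 ((ε : ℂ) * n) = (ε : ℂ) * (1 - I / (2 * (s : ℝ)) * ((ε : ℂ) * n)) := by
      rw [rotA, map_mul, conj_ofReal, ← hsdef]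
      linear_combination ((ε : ℂ) * (1 - I / (2 * (s : ℝ)) * ((ε : ℂ) * n))) * hn
    change rotA p n 1 ((ε : ℂ) * n) ∈ _
    rw [this]
    exact mul_mem_openSector hε h1
  · change rotB p n' ρ 1 ((ε : ℂ) * n) ∈ _
    rw [rotB, one_mul, mul_one]
    exact h2

/-- Letting PSL(2, ℂ) act on itself by left translation, with coordinates read off the first column,
makes the same ping-pong yield both freeness and discreteness. -/
theorem mem_closedDeformationSpace (h : PingPong p n n' ρ) (hp : 3 ≤ p) :
    ρ ∈ closedDeformationSpace (expRoot p) (expRoot p) := by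
  set a := toPSL (genA (expRoot p)) with ha
  set b := toPSL (genB (expRoot p) ρ) with hb
  let fA := columnFun (rotA p n)
  let fB := columnFun (rotB p n' ρ)
  let O := openSector (Real.pi / p)
  let C := closedSector (Real.pi / p)
  -- Complements of closed sectors, so that `rotA_mem` and `rotB_mem` land in open sectors; `U` uses
  -- open sectors in order to be open.
  let X : Set PSL2C := {g | fA g ∉ C}
  let Y : Set PSL2C := {g | fB g ∉ C}
  let U : Set PSL2C := {g | fA g ∈ O ∧ fB g ∈ O}
  have hOC : O ⊆ C := openSector_subset_closedSector _
  have hXU : Disjoint X U := Set.disjoint_left.2 fun g hX hU => hX (hOC hU.1)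
  have hYU : Disjoint Y U := Set.disjoint_left.2 fun g hY hU => hY (hOC hU.2)
  have hYA : ∀ g ∈ Y, fA g ∈ O := fun g hg => h.rotA_mem hp hg
  have hXB : ∀ g ∈ X, fB g ∈ O := fun g hg => h.rotB_mem hp hg
  have hpow : ∀ g : PSL2C, g ^ p = 1 → ∀ k : ℤ, (p : ℤ) ∣ k → g ^ k = 1 := by
    rintro g hg k ⟨m, rfl⟩
    rw [zpow_mul, zpow_natCast, hg, one_zpow]
  have hH : ∀ x ∈ Subgroup.zpowers a, x ≠ 1 → ∀ u ∈ U ∪ Y, x • u ∈ X := by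
    rintro x ⟨k, rfl⟩ hx u hu hmem
    apply hx
    refine hpow a (toPSL_pow_eq_one hp (trace_genA _)) k ?_
    have hfu : fA u ∈ O := hu.elim (fun hu => hu.1) (hYA u)
    refine dvd_of_mem_sector hp hfu ?_
    rw [← expRoot_val, zpow_mul]
    have := columnFun_zpow_mul (rotA_smul p n) (pow_ne_zero 2 (expRoot p).ne_zero)
      (rotA_genA hp n) k u
    exact this ▸ hmem
  have hK : ∀ x ∈ Subgroup.zpowers b, x ≠ 1 → ∀ u ∈ U ∪ X, x • u ∈ Y := by
    rintro x ⟨k, rfl⟩ hx u hu hmem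
    apply hx
    refine hpow b (toPSL_pow_eq_one hp (trace_genB _ _)) k ?_
    have hfu : fB u ∈ O := hu.elim (fun hu => hu.2) (hXB u)
    refine dvd_of_mem_sector hp hfu ?_
    rw [← expRoot_val, zpow_mul]
    have := columnFun_zpow_mul (rotB_smul p n' ρ) (pow_ne_zero 2 (expRoot p).ne_zero)
      (rotB_genB hp n' ρ) k u
    exact this ▸ hmem
  obtain ⟨M, hM⟩ := h.exists_mem hp
  have hu : toPSL M ∈ U := by
    refine ⟨?_, ?_⟩
    · change columnFun _ _ ∈ _; rw [columnFun_toPSL (rotA_smul p n)]; exact hM.1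
    · change columnFun _ _ ∈ _; rw [columnFun_toPSL (rotB_smul p n' ρ)]; exact hM.2
  have hping := fun (g : Monoid.Coprod (Subgroup.zpowers a) (Subgroup.zpowers b)) (hg : g ≠ 1) =>
    coprod_lift_smul_notMem hXU hYU hH hK hg hu
  have hUopen : IsOpen U :=
    ((isOpen_openSector _).preimage (continuous_columnFun (rotA_smul p n) (continuous_rotA p n))).inter
      ((isOpen_openSector _).preimage
        (continuous_columnFun (rotB_smul p n' ρ) (continuous_rotB p n' ρ)))
  constructor
  · have hrange : groupGamma (expRoot p) (expRoot p) ρ ≤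
        (Monoid.Coprod.lift (Subgroup.zpowers a).subtype (Subgroup.zpowers b).subtype).range := by
      rw [groupGamma, Subgroup.closure_le]
      rintro x (rfl | rfl)
      · exact ⟨Monoid.Coprod.inl ⟨a, Subgroup.mem_zpowers a⟩, by simp [ha]⟩
      · exact ⟨Monoid.Coprod.inr ⟨b, Subgroup.mem_zpowers b⟩, by simp [hb]⟩
    apply discreteTopology_of_isOpen_singleton_one
    -- Only the identity keeps the base point in the open set `U`, so the identity is isolated.
    have : ({1} : Set (groupGamma (expRoot p) (expRoot p) ρ)) =
        {g : groupGamma (expRoot p) (expRoot p) ρ | (g : PSL2C) * toPSL M ∈ U} := by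
      ext g
      refine ⟨fun hg => ?_, fun hg => ?_⟩
      · rw [Set.mem_singleton_iff] at hg; subst hg; simpa using hu
      · obtain ⟨y, hy⟩ := hrange g.2
        by_contra hne
        refine hping y ?_ ?_
        · rintro rfl
          rw [map_one] at hy
          exact hne (Subtype.ext hy.symm)
        · rw [hy]; exact hg
    rw [this]
    exact hUopen.preimage (by fun_prop)
  · refine (injective_iff_map_eq_one _).2 fun y hy => ?_
    by_contra hne
    refine hping y hne ?_
    rw [hy, one_smul]
    exact hu

end PingPong

namespace PingPong

variable {p : ℕ} {n n' ρ : ℂ}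

/-- The inequalities of the ping-pong criterion are strict at `τ ρ` for `τ > 1`, hence hold in
a neighbourhood. -/
theorem eventually (h : PingPong p n n' ρ) (hp : 3 ≤ p) {τ : ℝ} (hτ : 1 < τ) :
    ∀ᶠ σ in 𝓝 ((τ : ℂ) * ρ), PingPong p n n' σ := by
  have hs := sin_pi_div_pos hp
  have hfin : ∀ n, (sideNormals p n).Finite := fun n => (Set.finite_singleton _).insert _
  have key : ∀ᶠ σ in 𝓝 ((τ : ℂ) * ρ), ∀ P ∈ sideNormals p n, ∀ P' ∈ sideNormals p n',
      DiskInHalfPlane p σ P P' := by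
    rw [eventually_all_finite (hfin n)]
    intro P hP
    rw [eventually_all_finite (hfin n')]
    intro P' hP'
    obtain ⟨h₁, h₂, h₃⟩ := h.diskInHalfPlane P hP P' hP'
    have e : (P' * conj ((τ : ℂ) * ρ)).re = τ * (P' * conj ρ).re := by
      rw [map_mul, conj_ofReal, mul_left_comm, re_ofReal_mul]
    have c₂ : Continuous fun σ : ℂ => (P' * conj σ).re := by fun_prop
    have c₃ : Continuous fun σ : ℂ =>
        P.re * (P' * conj σ).re / (2 * Real.sin (Real.pi / p) ^ 2) := by fun_prop
    have l₂ : (P' * conj ((τ : ℂ) * ρ)).re < 0 := by rw [e]; nlinarith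
    have l₃ : 1 + (P * conj P').re
        < P.re * (P' * conj ((τ : ℂ) * ρ)).re / (2 * Real.sin (Real.pi / p) ^ 2) := by
      refine h₃.trans_lt ?_
      rw [e]
      gcongr ?_ / _
      -- The right-hand side is positive, so the factor τ > 1 increases it.
      nlinarith [mul_pos_of_neg_of_neg h₁ h₂]
    filter_upwards [c₂.continuousAt.eventually_lt_const l₂, c₃.continuousAt.eventually_const_lt l₃]
      with σ m₂ m₃
    exact ⟨h₁, m₂, m₃.le⟩
  filter_upwards [key] with σ hσ
  exact ⟨h.norm_left, h.norm_right, hσ⟩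

/-- The points τρ with τ > 1 are interior, and they tend to ρ as τ decreases to 1. -/
theorem mem_closure_deformationSpace (h : PingPong p n n' ρ) (hp : 3 ≤ p) :
    ρ ∈ closure (deformationSpace (expRoot p) (expRoot p)) := by
  have hc : Tendsto (fun τ : ℝ => (τ : ℂ) * ρ) (𝓝[>] 1) (𝓝 ρ) := by
    have : Continuous fun τ : ℝ => (τ : ℂ) * ρ := by fun_prop
    simpa using (this.tendsto 1).mono_left nhdsWithin_le_nhds
  refine mem_closure_of_tendsto hc ?_
  filter_upwards [self_mem_nhdsWithin] with τ hτ
  rw [deformationSpace, mem_interior_iff_mem_nhds]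
  filter_upwards [h.eventually hp hτ] with σ hσ
  exact hσ.mem_closedDeformationSpace hp

end PingPong

/-! ### Words, relations and boundary points -/

/-- Nonzero powers of a parabolic matrix are parabolic, hence not scalar. -/
theorem toPSL_pow_ne_one_of_isParabolic {M : SL2C} (hM : M.1.IsParabolic) {N : ℕ} (hN : N ≠ 0) :
    toPSL M ^ N ≠ 1 := by
  intro h
  rw [← map_pow, toPSL_eq_one_iff] at h
  obtain ⟨r, -, hr⟩ := h
  have hdet : IsUnit M.1.det := by rw [M.2]; exact isUnit_one
  have := Matrix.GeneralLinearGroup.IsParabolic.pow (g := Matrix.SpecialLinearGroup.toGL M) hM hN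
  apply this.1
  refine ⟨r, ?_⟩
  rw [Matrix.scalar_apply, ← Matrix.smul_one_eq_diagonal, ← hr]
  simp

/-- The matrix of a word in `A` (letter `true`) and `B_ρ` (letter `false`). -/
noncomputable def wordMatrix (p : ℕ) (ρ : ℂ) : FreeGroup Bool →* SL2C :=
  FreeGroup.lift fun i => bif i then genA (expRoot p) else genB (expRoot p) ρ

theorem toPSL_wordMatrix (p : ℕ) (ρ : ℂ) (w : FreeGroup Bool) :
    toPSL (wordMatrix p ρ w) = FreeGroup.lift
      (fun i => bif i then toPSL (genA (expRoot p)) else toPSL (genB (expRoot p) ρ)) w := by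
  rw [← MonoidHom.comp_apply]
  congr 1
  ext (_ | _) <;> simp [wordMatrix]

theorem toPSL_wordMatrix_mem (p : ℕ) (ρ : ℂ) (w : FreeGroup Bool) :
    toPSL (wordMatrix p ρ w) ∈ groupGamma (expRoot p) (expRoot p) ρ := by
  rw [toPSL_wordMatrix]
  have := FreeGroup.range_lift_le (f := fun i : Bool =>
    bif i then toPSL (genA (expRoot p)) else toPSL (genB (expRoot p) ρ))
    (s := groupGamma (expRoot p) (expRoot p) ρ) (by
      rintro _ ⟨_ | _, rfl⟩
      · exact Subgroup.subset_closure (Or.inr rfl)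
      · exact Subgroup.subset_closure (Or.inl rfl))
  exact this ⟨w, rfl⟩

theorem genB_pow (β : ℂˣ) (ρ : ℂ) (k : ℕ) :
    ((genB β ρ).1 ^ k) 0 0 = (β : ℂ) ^ k ∧ ((genB β ρ).1 ^ k) 0 1 = 0 ∧
      ((genB β ρ).1 ^ k) 1 1 = (β : ℂ)⁻¹ ^ k := by
  induction k with
  | zero => simp
  | succ k ih =>
    obtain ⟨h₀₀, h₀₁, h₁₁⟩ := ih
    have e : (genB β ρ).1 = !![(β : ℂ), 0; ρ, (β : ℂ)⁻¹] := rfl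
    rw [pow_succ]
    simp only [Matrix.mul_apply, Fin.sum_univ_two, h₀₀, h₀₁, h₁₁]
    simp [e, pow_succ]

/-- The order depends only on the diagonal: if B_σ ^ k is scalar then β ^ (2k) = 1, so p divides k.
This permits the transfer of relations between parameters. -/
theorem orderOf_toPSL_genB_dvd {p : ℕ} (hp : 3 ≤ p) (ρ σ : ℂ) :
    orderOf (toPSL (genB (expRoot p) ρ)) ∣ orderOf (toPSL (genB (expRoot p) σ)) := by
  set k := orderOf (toPSL (genB (expRoot p) σ)) with hk
  have h := pow_orderOf_eq_one (toPSL (genB (expRoot p) σ))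
  rw [← hk, ← map_pow, toPSL_eq_one_iff] at h
  obtain ⟨r, -, hr⟩ := h
  rw [Matrix.SpecialLinearGroup.coe_pow] at hr
  have hβ : (expRoot p : ℂ) ^ k = (expRoot p : ℂ)⁻¹ ^ k := by
    rw [← (genB_pow (expRoot p) σ k).1, ← (genB_pow (expRoot p) σ k).2.2, hr]
    simp
  have hdvd : (p : ℤ) ∣ k := by
    refine dvd_of_mem_sector hp (one_mem_openSector hp) ?_
    have : (expRoot p : ℂ) ^ (2 * (k : ℤ)) = 1 := by
      rw [two_mul, zpow_add₀ (expRoot p).ne_zero, zpow_natCast]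
      nth_rw 1 [hβ]
      rw [← mul_pow, inv_mul_cancel₀ (expRoot p).ne_zero, one_pow]
    rw [← expRoot_val, this, one_mul]
    exact openSector_subset_closedSector _ (one_mem_openSector hp)
  obtain ⟨m, hm⟩ := Int.natCast_dvd_natCast.1 hdvd
  rw [orderOf_dvd_iff_pow_eq_one, hm, pow_mul, toPSL_pow_eq_one hp (trace_genB _ _), one_pow]

/-- The eigenvalues are -e^{±iπ/m}, distinct because m ≥ 2, and their 2m-th powers are 1. The sign
makes the traces tend to -2. -/
theorem wordMatrix_trace_eq_two_cos {p : ℕ} {σ : ℂ} {w : FreeGroup Bool} {m : ℕ} (hm : 2 ≤ m)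
    (h : (wordMatrix p σ w).1.trace = (-2 * Real.cos (Real.pi / m) : ℝ)) :
    toPSL (wordMatrix p σ w) ^ (2 * m) = 1 := by
  have hm' : (2 : ℝ) ≤ m := by exact_mod_cast hm
  have hsin : 0 < Real.sin (Real.pi / m) := by
    have := Real.pi_pos
    exact Real.sin_pos_of_pos_of_lt_pi (by positivity) (div_lt_self this (by linarith))
  have hpow : (-(expRoot m : ℂ)) ^ (2 * m) = 1 := by
    rw [pow_mul, neg_sq, ← pow_mul, expRoot_val, ← exp_nat_mul, exp_eq_one_iff]
    refine ⟨1, ?_⟩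
    push_cast
    have : (m : ℂ) ≠ 0 := by exact_mod_cast (by omega : m ≠ 0)
    field_simp
  rw [← map_pow, toPSL_eq_one_iff]
  refine ⟨1, by norm_num, ?_⟩
  rw [Matrix.SpecialLinearGroup.coe_pow]
  refine pow_eq_smul_one_of_trace (u := -(expRoot m : ℂ)) (neg_ne_zero.2 (expRoot m).ne_zero) ?_
    hpow ?_ ?_
  · rw [inv_neg, ne_eq, neg_inj, expRoot_inv_eq, expRoot_eq]
    intro h
    have := congrArg im h
    simp [-ofReal_cos, -ofReal_sin] at this
    linarith
  · rw [inv_pow, hpow, inv_one]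
  · rw [h, inv_neg, expRoot_inv_eq, expRoot_eq]
    push_cast
    ring

/-- A point of the ping-pong region at which a word becomes parabolic is a cusp group, if the word
is elliptic of finite order at points arbitrarily near. -/
theorem PingPong.isCuspGroup {p : ℕ} {n n' ρ : ℂ} (h : PingPong p n n' ρ) (hp : 3 ≤ p)
    {w : FreeGroup Bool} (hw : (wordMatrix p ρ w).1.IsParabolic) {r : ℕ → ℂ}
    (hr : Tendsto r atTop (𝓝 ρ))
    (htr : ∀ᶠ m : ℕ in atTop, (wordMatrix p (r m) w).1.trace = (-2 * Real.cos (Real.pi / m) : ℝ)) :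
    IsCuspGroup p p ρ := by
  refine ⟨⟨h.mem_closure_deformationSpace hp, fun hint => ?_⟩, h.mem_closedDeformationSpace hp,
    toPSL (wordMatrix p ρ w), toPSL_wordMatrix_mem p ρ w, _, rfl, hw⟩
  -- If ρ were interior, some nearby `r m` would give a free product in which the 2m-th power of the
  -- word is trivial; this relation would hold at ρ too.
  rw [deformationSpace, interior_interior, mem_interior_iff_mem_nhds] at hint
  obtain ⟨m, ⟨hm, hmt⟩, hm2⟩ :=
    (((hr.eventually_mem hint).and htr).and (eventually_ge_atTop 2)).exists
  have hfin := wordMatrix_trace_eq_two_cos hm2 hmt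
  rw [← map_pow, ← map_pow, toPSL_wordMatrix] at hfin
  have := hm.2.lift_eq_one (a' := toPSL (genA (expRoot p))) (b' := toPSL (genB (expRoot p) ρ))
    dvd_rfl (orderOf_toPSL_genB_dvd hp _ _) hfin
  rw [← toPSL_wordMatrix, map_pow, map_pow] at this
  exact toPSL_pow_ne_one_of_isParabolic hw (by omega) this

/-! ### Ping-pong at the explicit points -/

theorem expRoot_re (p : ℕ) : (expRoot p : ℂ).re = Real.cos (Real.pi / p) := by
  simp [expRoot_eq, -ofReal_cos, -ofReal_sin]

theorem expRoot_im (p : ℕ) : (expRoot p : ℂ).im = Real.sin (Real.pi / p) := by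
  simp [expRoot_eq, -ofReal_cos, -ofReal_sin]

theorem expRoot_inv_re (p : ℕ) : ((expRoot p : ℂ)⁻¹).re = Real.cos (Real.pi / p) := by
  simp [expRoot_inv_eq, -ofReal_cos, -ofReal_sin]

theorem expRoot_inv_im (p : ℕ) : ((expRoot p : ℂ)⁻¹).im = -Real.sin (Real.pi / p) := by
  simp [expRoot_inv_eq, -ofReal_cos, -ofReal_sin]

theorem pingPong_iff {p : ℕ} {n n' ρ : ℂ} : PingPong p n n' ρ ↔ ‖n‖ = 1 ∧ ‖n'‖ = 1 ∧
    ∀ P ∈ sideNormals p n, ∀ P' ∈ sideNormals p n', DiskInHalfPlane p ρ P P' :=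
  ⟨fun h => ⟨h.1, h.2, h.3⟩, fun h => ⟨h.1, h.2.1, h.2.2⟩⟩

/-- The half-plane condition in real coordinates. -/
theorem diskInHalfPlane_iff {p : ℕ} (hp : 3 ≤ p) {ρ P P' : ℂ} : DiskInHalfPlane p ρ P P' ↔
    P.re < 0 ∧ P'.re * ρ.re + P'.im * ρ.im < 0 ∧
      (1 + P.re * P'.re + P.im * P'.im) * (2 * Real.sin (Real.pi / p) ^ 2)
        ≤ P.re * (P'.re * ρ.re + P'.im * ρ.im) := by
  have hs := sin_pi_div_pos hp
  rw [DiskInHalfPlane, le_div_iff₀ (by positivity)]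
  simp only [mul_re, conj_re, conj_im, mul_neg, sub_neg_eq_add, add_assoc]

/-- The third inequality reduces to Re(P P̄') ≤ 1, with equality when P' = P: those sides are
tangent. -/
theorem pingPong_four {p : ℕ} (hp : 3 ≤ p) : PingPong p I I 4 := by
  have hs := sin_pi_div_pos hp
  have hcs := Real.sin_sq_add_cos_sq (Real.pi / p)
  refine ⟨norm_I, norm_I, ?_⟩
  rintro P (rfl | rfl) P' (rfl | rfl) <;> rw [diskInHalfPlane_iff hp] <;>
    simp only [neg_re, neg_im, mul_re, mul_im, I_re, I_im, expRoot_re, expRoot_im, expRoot_inv_re,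
      expRoot_inv_im, re_ofNat, im_ofNat] <;>
    generalize Real.sin (Real.pi / p) = s at * <;> generalize Real.cos (Real.pi / p) = c at * <;>
    refine ⟨by linarith, by linarith, ?_⟩ <;>
    nlinarith [mul_nonneg (sq_nonneg s) (sq_nonneg c), mul_pos hs hs, sq_nonneg c]

/-- Here ρ = -4c², and equality occurs when P' is minus the conjugate of P. -/
theorem pingPong_neg_four_cos_sq {p : ℕ} (hp : 3 ≤ p) :
    PingPong p I (-I) (4 * Real.sin (Real.pi / p) ^ 2 - 4 : ℝ) := by
  have hs := sin_pi_div_pos hp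
  have hc := cos_pi_div_pos hp
  have hcs := Real.sin_sq_add_cos_sq (Real.pi / p)
  refine ⟨norm_I, by rw [norm_neg, norm_I], ?_⟩
  rintro P (rfl | rfl) P' (rfl | rfl) <;> rw [diskInHalfPlane_iff hp] <;>
    simp only [neg_re, neg_im, mul_re, mul_im, I_re, I_im, expRoot_re, expRoot_im, expRoot_inv_re,
      expRoot_inv_im, ofReal_re, ofReal_im] <;>
    generalize Real.sin (Real.pi / p) = s at * <;> generalize Real.cos (Real.pi / p) = c at * <;>
    rw [show 4 * s ^ 2 - 4 = -4 * c ^ 2 by linarith] <;>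
    refine ⟨by linarith, by nlinarith [mul_pos hs (mul_pos hc hc)], ?_⟩ <;>
    nlinarith [mul_nonneg (sq_nonneg s) (sq_nonneg c), mul_pos hs hs, sq_nonneg c]

/-- Half the imaginary part of the points at which the commutator of the generators is parabolic. -/
theorem sqrt_bounds {p : ℕ} (hp : 3 ≤ p) :
    √(1 - Real.sin (Real.pi / p) ^ 4) ^ 2 = 1 - Real.sin (Real.pi / p) ^ 4 ∧
      Real.sin (Real.pi / p) * Real.cos (Real.pi / p) < √(1 - Real.sin (Real.pi / p) ^ 4) := by
  have hs := sin_pi_div_pos hp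
  have hc := cos_pi_div_pos hp
  have hcs := Real.sin_sq_add_cos_sq (Real.pi / p)
  generalize Real.sin (Real.pi / p) = s at *
  generalize Real.cos (Real.pi / p) = c at *
  have h4 : 1 - s ^ 4 = c ^ 2 * (1 + s ^ 2) := by
    rw [show c ^ 2 = 1 - s ^ 2 by linarith]; ring
  refine ⟨Real.sq_sqrt (by rw [h4]; positivity), Real.lt_sqrt_of_sq_lt ?_⟩
  rw [h4]
  nlinarith [mul_pos hc hc]

/-- The direction is n = ρ/2, a unit because s⁴ + (1 - s⁴) = 1. All four side pairs give equality.
-/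
theorem pingPong_commutator {p : ℕ} (hp : 3 ≤ p) :
    PingPong p ⟨Real.sin (Real.pi / p) ^ 2, √(1 - Real.sin (Real.pi / p) ^ 4)⟩ (-1)
      ⟨2 * Real.sin (Real.pi / p) ^ 2, 2 * √(1 - Real.sin (Real.pi / p) ^ 4)⟩ := by
  have hs := sin_pi_div_pos hp
  have hc := cos_pi_div_pos hp
  have hcs := Real.sin_sq_add_cos_sq (Real.pi / p)
  obtain ⟨hh, hlt⟩ := sqrt_bounds hp
  rw [pingPong_iff, norm_def, normSq_mk]
  refine ⟨?_, by simp, ?_⟩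
  · rw [Real.sqrt_eq_one]; nlinarith
  rintro P (rfl | rfl) P' (rfl | rfl) <;> rw [diskInHalfPlane_iff hp] <;>
    simp only [neg_re, neg_im, mul_re, mul_im, one_re, one_im, expRoot_re, expRoot_im,
      expRoot_inv_re, expRoot_inv_im, neg_zero, zero_mul, sub_zero, add_zero] <;>
    generalize √(1 - Real.sin (Real.pi / p) ^ 4) = h at * <;>
    generalize Real.sin (Real.pi / p) = s at * <;> generalize Real.cos (Real.pi / p) = c at * <;>
    have hpos : 0 < h := lt_trans (mul_pos hs hc) hlt <;>
    have e₁ := mul_pos hs (sub_pos.2 hlt) <;>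
    have e₂ := mul_pos hs hpos <;>
    have e₃ := mul_pos (mul_pos hs hs) hc <;>
    refine ⟨by nlinarith, by nlinarith, le_of_eq ?_⟩ <;>
    clear e₁ e₂ e₃ hpos hlt hc hs <;>
    grind

theorem DiskInHalfPlane.conj {p : ℕ} {ρ P P' : ℂ} (h : DiskInHalfPlane p ρ P P') :
    DiskInHalfPlane p (conj ρ) (conj P) (conj P') := by
  obtain ⟨h₁, h₂, h₃⟩ := h
  refine ⟨by simpa using h₁, by simpa using h₂, by simpa using h₃⟩

/-- The ping-pong criterion is invariant under complex conjugation. -/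
theorem PingPong.conj {p : ℕ} {n n' ρ : ℂ} (h : PingPong p n n' ρ) :
    PingPong p (-conj n) (-conj n') (conj ρ) := by
  have key : ∀ (m P : ℂ), P ∈ sideNormals p (-(starRingEnd ℂ) m) →
      (starRingEnd ℂ) P ∈ sideNormals p m := by
    have hc' : (starRingEnd ℂ) (expRoot p : ℂ)⁻¹ = (expRoot p : ℂ) := by
      rw [map_inv₀, conj_expRoot, inv_inv]
    rintro m P (rfl | rfl)
    · right
      rw [map_mul, map_neg, conj_conj, conj_expRoot, neg_mul]
      rfl
    · left
      rw [map_neg, map_mul, map_neg, conj_conj, hc', neg_mul, neg_neg]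
  refine ⟨by simpa using h.norm_left, by simpa using h.norm_right, fun P hP P' hP' => ?_⟩
  simpa using (h.diskInHalfPlane _ (key n P hP) _ (key n' P' hP')).conj

/-! ### Traces of the three words -/

theorem isParabolic_of_trace {M : SL2C} (h : M.1 0 1 ≠ 0) (ht : M.1.trace = -2) :
    M.1.IsParabolic := by
  refine ⟨?_, ?_⟩
  · rintro ⟨r, hr⟩
    apply h
    rw [← hr]
    simp
  · rw [Matrix.discr_fin_two, ht, M.2]
    norm_num

theorem coe_genA (α : ℂˣ) : (genA α).1 = !![(α : ℂ), 1; 0, (α : ℂ)⁻¹] := rfl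

theorem coe_genB (β : ℂˣ) (ρ : ℂ) : (genB β ρ).1 = !![(β : ℂ), 0; ρ, (β : ℂ)⁻¹] := rfl

theorem matrix_fin_two_congr {a b c d a' b' c' d' : ℂ} (ha : a = a') (hb : b = b') (hc : c = c')
    (hd : d = d') : !![a, b; c, d] = !![a', b'; c', d'] := by
  rw [ha, hb, hc, hd]

theorem coe_wordMatrix_mul_inv (p : ℕ) (ρ : ℂ) :
    (wordMatrix p ρ (.of true * (.of false)⁻¹)).1
      = !![1 - ρ, (expRoot p : ℂ); -(expRoot p : ℂ)⁻¹ * ρ, 1] := by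
  have := (expRoot p).ne_zero
  rw [map_mul, map_inv, wordMatrix, FreeGroup.lift_apply_of, FreeGroup.lift_apply_of,
    Matrix.SpecialLinearGroup.coe_mul, Matrix.SpecialLinearGroup.coe_inv, cond_true, cond_false,
    coe_genA, coe_genB, Matrix.adjugate_fin_two_of, Matrix.mul_fin_two]
  apply matrix_fin_two_congr <;> first | ring1 | (field_simp; done) | (field_simp; ring1)

theorem coe_wordMatrix_mul (p : ℕ) (ρ : ℂ) :
    (wordMatrix p ρ (.of true * .of false)).1
      = !![(expRoot p : ℂ) ^ 2 + ρ, (expRoot p : ℂ)⁻¹;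
          (expRoot p : ℂ)⁻¹ * ρ, ((expRoot p : ℂ)⁻¹) ^ 2] := by
  rw [map_mul, wordMatrix, FreeGroup.lift_apply_of, FreeGroup.lift_apply_of,
    Matrix.SpecialLinearGroup.coe_mul, cond_true, cond_false, coe_genA, coe_genB,
    Matrix.mul_fin_two]
  apply matrix_fin_two_congr <;> ring

theorem coe_wordMatrix_commutator (p : ℕ) (ρ : ℂ) :
    (wordMatrix p ρ (.of true * .of false * ((.of true)⁻¹ * (.of false)⁻¹))).1
      = !![(expRoot p : ℂ) ^ 2 + ρ, (expRoot p : ℂ)⁻¹;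
          (expRoot p : ℂ)⁻¹ * ρ, ((expRoot p : ℂ)⁻¹) ^ 2] *
        !![((expRoot p : ℂ)⁻¹) ^ 2 + ρ, -(expRoot p : ℂ);
          -(expRoot p : ℂ) * ρ, (expRoot p : ℂ) ^ 2] := by
  rw [map_mul, Matrix.SpecialLinearGroup.coe_mul, coe_wordMatrix_mul, map_mul, map_inv, map_inv,
    wordMatrix, FreeGroup.lift_apply_of, FreeGroup.lift_apply_of,
    Matrix.SpecialLinearGroup.coe_mul, cond_true, cond_false, Matrix.SpecialLinearGroup.coe_inv,
    Matrix.SpecialLinearGroup.coe_inv, coe_genA, coe_genB,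
    Matrix.adjugate_fin_two_of, Matrix.adjugate_fin_two_of]
  congr 1
  rw [Matrix.mul_fin_two]
  apply matrix_fin_two_congr <;> ring

theorem trace_wordMatrix_mul_inv (p : ℕ) (ρ : ℂ) :
    (wordMatrix p ρ (.of true * (.of false)⁻¹)).1.trace = 2 - ρ := by
  rw [coe_wordMatrix_mul_inv, Matrix.trace_fin_two_of]
  ring

theorem trace_wordMatrix_mul (p : ℕ) (ρ : ℂ) :
    (wordMatrix p ρ (.of true * .of false)).1.trace
      = ρ + (2 - 4 * Real.sin (Real.pi / p) ^ 2 : ℝ) := by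
  have hcs : ((Real.sin (Real.pi / p) : ℝ) : ℂ) ^ 2 + ((Real.cos (Real.pi / p) : ℝ) : ℂ) ^ 2 = 1 := by
    exact_mod_cast Real.sin_sq_add_cos_sq (Real.pi / p)
  rw [coe_wordMatrix_mul, Matrix.trace_fin_two_of, expRoot_inv_eq, expRoot_eq]
  push_cast [-ofReal_sin, -ofReal_cos]
  linear_combination 2 * hcs + 2 * ((Real.sin (Real.pi / p) : ℝ) : ℂ) ^ 2 * I_sq

theorem trace_wordMatrix_commutator (p : ℕ) (ρ : ℂ) :
    (wordMatrix p ρ (.of true * .of false * ((.of true)⁻¹ * (.of false)⁻¹))).1.trace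
      = (ρ - (2 * Real.sin (Real.pi / p) ^ 2 : ℝ)) ^ 2
        + (2 - 4 * Real.sin (Real.pi / p) ^ 4 : ℝ) := by
  have hcs : ((Real.sin (Real.pi / p) : ℝ) : ℂ) ^ 2 + ((Real.cos (Real.pi / p) : ℝ) : ℂ) ^ 2 = 1 := by
    exact_mod_cast Real.sin_sq_add_cos_sq (Real.pi / p)
  have h1 : (expRoot p : ℂ) * (expRoot p : ℂ)⁻¹ = 1 := mul_inv_cancel₀ (expRoot p).ne_zero
  have h2 : (expRoot p : ℂ) ^ 2 + (expRoot p : ℂ)⁻¹ ^ 2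
      = 2 - 4 * ((Real.sin (Real.pi / p) : ℝ) : ℂ) ^ 2 := by
    rw [expRoot_inv_eq, expRoot_eq]
    linear_combination 2 * hcs + 2 * ((Real.sin (Real.pi / p) : ℝ) : ℂ) ^ 2 * I_sq
  rw [coe_wordMatrix_commutator, Matrix.mul_fin_two, Matrix.trace_fin_two_of]
  push_cast [-ofReal_sin, -ofReal_cos]
  generalize (expRoot p : ℂ) = a at *
  generalize a⁻¹ = b at *
  have h3 : a ^ 2 * b ^ 2 = 1 := by rw [← mul_pow, h1, one_pow]
  have h4 : b ^ 2 * ρ + a ^ 2 * ρ = ρ * (2 - 4 * ((Real.sin (Real.pi / p) : ℝ) : ℂ) ^ 2) := by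
    rw [← h2]; ring
  linear_combination 2 * h3 + h4 - 2 * ρ * h1

/-! ### The four cusp groups -/

theorem tendsto_cos_pi_div : Tendsto (fun m : ℕ => Real.cos (Real.pi / m)) atTop (𝓝 1) := by
  have h : Tendsto (fun m : ℕ => Real.pi / (m : ℝ)) atTop (𝓝 0) :=
    tendsto_const_div_atTop_nhds_zero_nat Real.pi
  have := (Real.continuous_cos.tendsto 0).comp h
  rwa [Real.cos_zero] at this

theorem isCuspGroup_four {p : ℕ} (hp : 3 ≤ p) : IsCuspGroup p p 4 := by
  refine (pingPong_four hp).isCuspGroup hp (w := .of true * (.of false)⁻¹)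
    -- Solves 2 - r = -2cos(π/m).
    (r := fun m => (2 + 2 * Real.cos (Real.pi / m) : ℝ)) (isParabolic_of_trace ?_ ?_) ?_ ?_
  · rw [coe_wordMatrix_mul_inv]
    exact (expRoot p).ne_zero
  · rw [trace_wordMatrix_mul_inv]; norm_num
  · have : Tendsto (fun m : ℕ => 2 + 2 * Real.cos (Real.pi / m)) atTop (𝓝 (2 + 2 * 1)) :=
      (tendsto_cos_pi_div.const_mul 2).const_add 2
    rw [show (4 : ℂ) = ((2 + 2 * 1 : ℝ) : ℂ) by norm_num]
    exact (continuous_ofReal.tendsto _).comp this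
  · refine Eventually.of_forall fun m => ?_
    rw [trace_wordMatrix_mul_inv]
    push_cast; ring

theorem isCuspGroup_neg_four_cos_sq {p : ℕ} (hp : 3 ≤ p) :
    IsCuspGroup p p (4 * Real.sin (Real.pi / p) ^ 2 - 4 : ℝ) := by
  refine (pingPong_neg_four_cos_sq hp).isCuspGroup hp (w := .of true * .of false)
    -- Solves r + 2 - 4s² = -2cos(π/m).
    (r := fun m => (4 * Real.sin (Real.pi / p) ^ 2 - 2 - 2 * Real.cos (Real.pi / m) : ℝ))
    (isParabolic_of_trace ?_ ?_) ?_ ?_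
  · rw [coe_wordMatrix_mul]
    exact inv_ne_zero (expRoot p).ne_zero
  · rw [trace_wordMatrix_mul, ← ofReal_add]; norm_num
  · have : Tendsto (fun m : ℕ => 4 * Real.sin (Real.pi / p) ^ 2 - 2 - 2 * Real.cos (Real.pi / m))
        atTop (𝓝 (4 * Real.sin (Real.pi / p) ^ 2 - 2 - 2 * 1)) :=
      (tendsto_cos_pi_div.const_mul 2).const_sub _
    rw [show 4 * Real.sin (Real.pi / p) ^ 2 - 4 = 4 * Real.sin (Real.pi / p) ^ 2 - 2 - 2 * 1 by ring]
    exact (continuous_ofReal.tendsto _).comp this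
  · refine Eventually.of_forall fun m => ?_
    rw [trace_wordMatrix_mul, ← ofReal_add]
    congr 1; ring

/-- A cusp group at which the commutator of the generators is parabolic. -/
theorem PingPong.isCuspGroup_commutator {p : ℕ} (hp : 3 ≤ p) {n n' : ℂ} {ε : ℝ} (hε : ε ^ 2 = 1)
    (h : PingPong p n n' ⟨2 * Real.sin (Real.pi / p) ^ 2,
      ε * (2 * √(1 - Real.sin (Real.pi / p) ^ 4))⟩) :
    IsCuspGroup p p
      ⟨2 * Real.sin (Real.pi / p) ^ 2, ε * (2 * √(1 - Real.sin (Real.pi / p) ^ 4))⟩ := by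
  obtain ⟨hh, hlt⟩ := sqrt_bounds hp
  have hs := sin_pi_div_pos hp
  have hc := cos_pi_div_pos hp
  have htr : ∀ y : ℝ, (wordMatrix p ⟨2 * Real.sin (Real.pi / p) ^ 2, ε * y⟩
      (.of true * .of false * ((.of true)⁻¹ * (.of false)⁻¹))).1.trace
        = (2 - 4 * Real.sin (Real.pi / p) ^ 4 - y ^ 2 : ℝ) := by
    intro y
    rw [trace_wordMatrix_commutator, mk_eq_add_mul_I, add_sub_cancel_left]
    have hε' : (ε : ℂ) ^ 2 = 1 := by exact_mod_cast hε
    push_cast [-ofReal_sin]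
    linear_combination (ε : ℂ) ^ 2 * y ^ 2 * I_sq - (y : ℂ) ^ 2 * hε'
  have hlim : Tendsto (fun m : ℕ => 2 - 4 * Real.sin (Real.pi / p) ^ 4
      + 2 * Real.cos (Real.pi / m)) atTop (𝓝 (2 - 4 * Real.sin (Real.pi / p) ^ 4 + 2 * 1)) :=
    (tendsto_cos_pi_div.const_mul 2).const_add _
  have e4 : 2 - 4 * Real.sin (Real.pi / p) ^ 4 + 2 * 1
      = (2 * √(1 - Real.sin (Real.pi / p) ^ 4)) ^ 2 := by rw [mul_pow, hh]; ring
  have hpos : 0 < 2 * √(1 - Real.sin (Real.pi / p) ^ 4) := by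
    linarith [mul_pos hs hc]
  rw [e4] at hlim
  refine h.isCuspGroup hp (w := .of true * .of false * ((.of true)⁻¹ * (.of false)⁻¹))
    -- On the line Re ρ = 2s² the trace is 2 - 4s⁴ - (Im ρ)²; this height makes it -2cos(π/m) once
    -- the radicand is nonnegative.
    (r := fun m => ⟨2 * Real.sin (Real.pi / p) ^ 2,
      ε * √(2 - 4 * Real.sin (Real.pi / p) ^ 4 + 2 * Real.cos (Real.pi / m))⟩)
    (isParabolic_of_trace ?_ ?_) ?_ ?_
  -- The upper right entry is -α(α² - 1 + ρ). Its vanishing would give ε√(1-s⁴) = -sc, contrary to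
  -- `sqrt_bounds`.
  · rw [coe_wordMatrix_commutator, Matrix.mul_fin_two]
    have h1 : (expRoot p : ℂ) * (expRoot p : ℂ)⁻¹ = 1 := mul_inv_cancel₀ (expRoot p).ne_zero
    intro h0
    have h0' : (expRoot p : ℂ) * ((expRoot p : ℂ) ^ 2 - 1 + ⟨2 * Real.sin (Real.pi / p) ^ 2,
        ε * (2 * √(1 - Real.sin (Real.pi / p) ^ 4))⟩) = 0 := by
      simp only [Matrix.of_apply, Matrix.cons_val', Matrix.cons_val_zero, Matrix.cons_val_one,
        Matrix.cons_val_fin_one] at h0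
      linear_combination -h0 + (expRoot p : ℂ) * h1
    have h0'' := congrArg im ((mul_eq_zero.1 h0').resolve_left (expRoot p).ne_zero)
    simp only [add_im, sub_im, one_im, zero_im, sq, mul_im, expRoot_re, expRoot_im] at h0''
    have : (√(1 - Real.sin (Real.pi / p) ^ 4)) ^ 2
        = (Real.sin (Real.pi / p) * Real.cos (Real.pi / p)) ^ 2 := by
      have hlin : ε * √(1 - Real.sin (Real.pi / p) ^ 4)
          = -(Real.sin (Real.pi / p) * Real.cos (Real.pi / p)) := by linarith
      rw [← neg_sq (_ * _), ← hlin, mul_pow, hε, one_mul]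
    nlinarith [mul_pos hs hc]
  · rw [htr, ← e4]
    push_cast; ring
  · have h1 : Tendsto (fun m : ℕ => √(2 - 4 * Real.sin (Real.pi / p) ^ 4
        + 2 * Real.cos (Real.pi / m))) atTop (𝓝 (2 * √(1 - Real.sin (Real.pi / p) ^ 4))) := by
      have := (Real.continuous_sqrt.tendsto _).comp hlim
      rwa [Real.sqrt_sq hpos.le] at this
    have h2 : Continuous fun y : ℝ => (⟨2 * Real.sin (Real.pi / p) ^ 2, ε * y⟩ : ℂ) := by
      simp only [mk_eq_add_mul_I]
      fun_prop
    exact (h2.tendsto _).comp h1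
  · filter_upwards [hlim.eventually_const_lt (by positivity : (0 : ℝ) < _)] with m hm
    rw [htr, Real.sq_sqrt hm.le]
    congr 1; ring

theorem isCuspGroup_commutator {p : ℕ} (hp : 3 ≤ p) :
    IsCuspGroup p p
      ⟨2 * Real.sin (Real.pi / p) ^ 2, 2 * √(1 - Real.sin (Real.pi / p) ^ 4)⟩ := by
  have := PingPong.isCuspGroup_commutator hp (one_pow 2) (n := _) (n' := _)
    (by rw [one_mul]; exact pingPong_commutator hp)
  rwa [one_mul] at this

theorem isCuspGroup_commutator_conj {p : ℕ} (hp : 3 ≤ p) :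
    IsCuspGroup p p
      ⟨2 * Real.sin (Real.pi / p) ^ 2, -(2 * √(1 - Real.sin (Real.pi / p) ^ 4))⟩ := by
  have := PingPong.isCuspGroup_commutator hp (ε := -1) (by norm_num) (n := _) (n' := _)
    (by rw [neg_one_mul]; exact (pingPong_commutator hp).conj)
  rwa [neg_one_mul] at this

/-! ### Hexagons symmetric in two axes -/

/-- The six linear forms whose upper bounds define a hexagon which is symmetric in the lines
`Re z = x` and `Im z = 0`. -/
def hexForm (x κ : ℝ) (i : Fin 6) (z : ℂ) : ℝ :=
  (![1, 0, -1, -1, 0, 1] : Fin 6 → ℝ) i * (z.re - x)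
    + (![κ, 1, κ, -κ, -1, -κ] : Fin 6 → ℝ) i * z.im

/-- The upper bounds of the six linear forms. -/
def hexBound (W H : ℝ) : Fin 6 → ℝ := ![W, H, W, W, H, W]

/-- The vertices of the hexagon. -/
def hexVertex (x κ W H : ℝ) : Fin 6 → ℂ :=
  ![⟨x + W, 0⟩, ⟨x + (W - κ * H), H⟩, ⟨x - (W - κ * H), H⟩, ⟨x - W, 0⟩, ⟨x - (W - κ * H), -H⟩,
    ⟨x + (W - κ * H), -H⟩]

/-- The open hexagon. -/
def hexOpen (x κ W H : ℝ) : Set ℂ := {z | ∀ i, hexForm x κ i z < hexBound W H i}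

/-- The closed hexagon. -/
def hexClosed (x κ W H : ℝ) : Set ℂ := {z | ∀ i, hexForm x κ i z ≤ hexBound W H i}

/-- The lines that carry the edges of the hexagon. -/
def hexLine (x κ W H : ℝ) (i : Fin 6) : Set ℂ := {z | hexForm x κ i z = hexBound W H i}

theorem hexForm_combo (x κ : ℝ) (i : Fin 6) {a b : ℝ} (hab : a + b = 1) (z w : ℂ) :
    hexForm x κ i (a • z + b • w) = a * hexForm x κ i z + b * hexForm x κ i w := by
  simp only [hexForm, add_re, add_im, real_smul, re_ofReal_mul, im_ofReal_mul]
  linear_combination ((![1, 0, -1, -1, 0, 1] : Fin 6 → ℝ) i * x) * hab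

theorem continuous_hexForm (x κ : ℝ) (i : Fin 6) : Continuous (hexForm x κ i) := by
  unfold hexForm
  fun_prop

theorem hexForm_center (x κ : ℝ) (i : Fin 6) : hexForm x κ i (x : ℂ) = 0 := by
  simp [hexForm]

section Hexagon

variable {x κ W H : ℝ}

/-- The incidence table of vertices and lines, on which the edges, convex independence and
distinctness of the lines rest. -/
theorem hexForm_vertex (hκ : 0 < κ) (hH : 0 < H) (hW : κ * H < W) (i j : Fin 6) :
    hexForm x κ j (hexVertex x κ W H i) ≤ hexBound W H j ∧
      (hexForm x κ j (hexVertex x κ W H i) = hexBound W H j ↔ i = j ∨ i = j + 1) := by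
  have := mul_pos hκ hH
  fin_cases i <;> fin_cases j <;> simp [hexForm, hexVertex, hexBound] <;>
    (try constructor) <;> (try intro _) <;> (try linarith)

theorem hexBound_pos (hκ : 0 < κ) (hH : 0 < H) (hW : κ * H < W) (i : Fin 6) :
    0 < hexBound W H i := by
  have := mul_pos hκ hH
  have hW' : 0 < W := by linarith
  fin_cases i <;> simp [hexBound, hW', hH]

theorem hexOpen_subset_hexClosed : hexOpen x κ W H ⊆ hexClosed x κ W H :=
  fun _ hz i => (hz i).le

theorem isOpen_hexOpen : IsOpen (hexOpen x κ W H) := by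
  simp only [hexOpen, Set.ofPred_forall]
  exact isOpen_iInter_of_finite fun i => isOpen_lt (continuous_hexForm x κ i) continuous_const

theorem isClosed_hexClosed : IsClosed (hexClosed x κ W H) := by
  simp only [hexClosed, Set.ofPred_forall]
  exact isClosed_iInter fun i => isClosed_le (continuous_hexForm x κ i) continuous_const

theorem convex_hexOpen : Convex ℝ (hexOpen x κ W H) := by
  intro z hz w hw a b ha hb hab i
  rw [hexForm_combo x κ i hab]
  rcases ha.eq_or_lt with rfl | ha
  · obtain rfl : b = 1 := by linarith
    simpa using hw i
  · have := hz i
    have := hw i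
    have e : a * hexBound W H i + b * hexBound W H i = hexBound W H i := by rw [← add_mul, hab, one_mul]
    have h1 := mul_lt_mul_of_pos_left (hz i) ha
    have h2 := mul_le_mul_of_nonneg_left (hw i).le hb
    linarith

theorem convex_hexClosed : Convex ℝ (hexClosed x κ W H) := by
  intro z hz w hw a b ha hb hab i
  rw [hexForm_combo x κ i hab]
  have e : a * hexBound W H i + b * hexBound W H i = hexBound W H i := by rw [← add_mul, hab, one_mul]
  have h1 := mul_le_mul_of_nonneg_left (hz i) ha
  have h2 := mul_le_mul_of_nonneg_left (hw i) hb
  linarith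

theorem center_mem_hexOpen (hκ : 0 < κ) (hH : 0 < H) (hW : κ * H < W) :
    (x : ℂ) ∈ hexOpen x κ W H := by
  intro i
  rw [hexForm_center]
  exact hexBound_pos hκ hH hW i

/-- Moving a point of the closed hexagon towards the centre, where the forms vanish and the bounds
are positive, makes every inequality strict. -/
theorem closure_hexOpen (hκ : 0 < κ) (hH : 0 < H) (hW : κ * H < W) :
    closure (hexOpen x κ W H) = hexClosed x κ W H := by
  refine (closure_minimal hexOpen_subset_hexClosed isClosed_hexClosed).antisymm fun z hz => ?_
  have hc : Continuous fun t : ℝ => (1 - t) • (x : ℂ) + t • z := by fun_prop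
  have hlim : Tendsto (fun t : ℝ => (1 - t) • (x : ℂ) + t • z) (𝓝[<] 1) (𝓝 z) := by
    have := (hc.tendsto 1).mono_left (nhdsWithin_le_nhds (s := Set.Iio 1))
    simpa using this
  refine mem_closure_of_tendsto hlim ?_
  filter_upwards [Ioo_mem_nhdsLT (zero_lt_one' ℝ)] with t ht i
  rw [hexForm_combo x κ i (by ring), hexForm_center, mul_zero, zero_add]
  have h1 := mul_le_mul_of_nonneg_left (hz i) ht.1.le
  have h2 := mul_lt_mul_of_pos_right ht.2 (hexBound_pos hκ hH hW i)
  linarith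

theorem interior_hexClosed (hκ : 0 < κ) (hH : 0 < H) (hW : κ * H < W) :
    interior (hexClosed x κ W H) = hexOpen x κ W H := by
  rw [← closure_hexOpen hκ hH hW, convex_hexOpen.interior_closure_eq_interior_of_nonempty_interior,
    isOpen_hexOpen.interior_eq]
  rw [isOpen_hexOpen.interior_eq]
  exact ⟨_, center_mem_hexOpen hκ hH hW⟩

theorem mem_segment_of_coord {a b z : ℂ} {t : ℝ} (h₀ : 0 ≤ t) (h₁ : t ≤ 1)
    (hre : z.re = a.re + t * (b.re - a.re)) (him : z.im = a.im + t * (b.im - a.im)) :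
    z ∈ segment ℝ a b := by
  refine ⟨1 - t, t, by linarith, h₀, by ring, ?_⟩
  apply Complex.ext
  · simp only [add_re, real_smul, re_ofReal_mul]
    linarith
  · simp only [add_im, real_smul, im_ofReal_mul]
    linarith

theorem mem_hexClosed_iff {z : ℂ} : z ∈ hexClosed x κ W H ↔
    z.re - x + κ * z.im ≤ W ∧ z.im ≤ H ∧ -(z.re - x) + κ * z.im ≤ W ∧
      -(z.re - x) - κ * z.im ≤ W ∧ -z.im ≤ H ∧ z.re - x - κ * z.im ≤ W := by
  rw [hexClosed, Set.mem_ofPred_eq, Fin.forall_fin_succ, Fin.forall_fin_succ, Fin.forall_fin_succ,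
    Fin.forall_fin_succ, Fin.forall_fin_succ, Fin.forall_fin_one]
  simp [hexForm, hexBound, sub_eq_add_neg]

theorem mem_hexOpen_iff {z : ℂ} : z ∈ hexOpen x κ W H ↔
    z.re - x + κ * z.im < W ∧ z.im < H ∧ -(z.re - x) + κ * z.im < W ∧
      -(z.re - x) - κ * z.im < W ∧ -z.im < H ∧ z.re - x - κ * z.im < W := by
  rw [hexOpen, Set.mem_ofPred_eq, Fin.forall_fin_succ, Fin.forall_fin_succ, Fin.forall_fin_succ,
    Fin.forall_fin_succ, Fin.forall_fin_succ, Fin.forall_fin_one]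
  simp [hexForm, hexBound, sub_eq_add_neg]

theorem hexLine_inter_hexClosed (hκ : 0 < κ) (hH : 0 < H) (hW : κ * H < W) (i : Fin 6) :
    hexLine x κ W H i ∩ hexClosed x κ W H
      = segment ℝ (hexVertex x κ W H i) (hexVertex x κ W H (i + 1)) := by
  apply Set.Subset.antisymm
  · rintro z ⟨hz, hK⟩
    obtain ⟨h0, h1, h2, h3, h4, h5⟩ := mem_hexClosed_iff.1 hK
    have hD : 0 < 2 * (W - κ * H) := by linarith
    have hne : W - κ * H ≠ 0 := by linarith
    fin_cases i <;> simp [hexLine, hexForm, hexBound] at hz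
    -- The parameter along an edge is affine in the height on slanted edges and in the real part on
    -- horizontal ones.
    · refine mem_segment_of_coord (t := z.im / H) (div_nonneg (by nlinarith) hH.le)
        ((div_le_one hH).2 h1) ?_ ?_ <;> simp [hexVertex] <;> field_simp <;> nlinarith
    · refine mem_segment_of_coord (t := (x + (W - κ * H) - z.re) / (2 * (W - κ * H)))
        (div_nonneg (by nlinarith) hD.le) ((div_le_one hD).2 (by nlinarith)) ?_ ?_
      · simp [hexVertex]; field_simp; ring
      · simp [hexVertex, hz]
    · refine mem_segment_of_coord (t := (H - z.im) / H) (div_nonneg (by linarith) hH.le)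
        ((div_le_one hH).2 (by nlinarith)) ?_ ?_ <;> simp [hexVertex] <;> field_simp <;> nlinarith
    · refine mem_segment_of_coord (t := - z.im / H) (div_nonneg (by nlinarith) hH.le)
        ((div_le_one hH).2 h4) ?_ ?_ <;> simp [hexVertex] <;> field_simp <;> nlinarith
    · have hz' : z.im = -H := by linarith
      rw [hz'] at h0 h2 h3 h5
      refine mem_segment_of_coord (t := (z.re - (x - (W - κ * H))) / (2 * (W - κ * H)))
        (div_nonneg (by nlinarith) hD.le) ((div_le_one hD).2 (by nlinarith)) ?_ ?_
      · simp [hexVertex]; field_simp; ring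
      · simp [hexVertex, hz']
    · refine mem_segment_of_coord (t := (H + z.im) / H) (div_nonneg (by linarith) hH.le)
        ((div_le_one hH).2 (by nlinarith)) ?_ ?_ <;> simp [hexVertex] <;> field_simp <;> nlinarith
  · have hv := fun k j => hexForm_vertex (x := x) hκ hH hW k j
    refine Set.subset_inter ?_ ?_
    · rintro _ ⟨a, b, ha, hb, hab, rfl⟩
      change hexForm x κ i _ = _
      rw [hexForm_combo x κ i hab, (hv i i).2.2 (Or.inl rfl), (hv (i + 1) i).2.2 (Or.inr rfl),
        ← add_mul, hab, one_mul]
    · exact convex_hexClosed.segment_subset (fun j => (hv i j).1) fun j => (hv (i + 1) j).1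

/-- A point lies on the horizontal chord through it, whose two ends are on slanted edges. -/
theorem hexClosed_eq_convexHull (hκ : 0 < κ) (hH : 0 < H) (hW : κ * H < W) :
    hexClosed x κ W H = convexHull ℝ (Set.range (hexVertex x κ W H)) := by
  apply Set.Subset.antisymm
  · intro z hz
    obtain ⟨h0, h1, h2, h3, h4, h5⟩ := mem_hexClosed_iff.1 hz
    have hv : ∀ i, hexVertex x κ W H i ∈ convexHull ℝ (Set.range (hexVertex x κ W H)) :=
      fun i => subset_convexHull ℝ _ ⟨i, rfl⟩
    have hcv := convex_convexHull ℝ (Set.range (hexVertex x κ W H))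
    have hseg : ∀ i, segment ℝ (hexVertex x κ W H i) (hexVertex x κ W H (i + 1))
        ⊆ convexHull ℝ (Set.range (hexVertex x κ W H)) := fun i =>
      hcv.segment_subset (hv _) (hv _)
    have hw : 0 < W - κ * |z.im| := by
      have : |z.im| ≤ H := abs_le.2 ⟨by linarith, h1⟩
      nlinarith
    have hR : (⟨x + (W - κ * |z.im|), z.im⟩ : ℂ)
        ∈ convexHull ℝ (Set.range (hexVertex x κ W H)) := by
      rcases le_total 0 z.im with hy | hy
      · rw [abs_of_nonneg hy] at *
        refine hseg 0 (mem_segment_of_coord (t := z.im / H) (div_nonneg hy hH.le)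
          ((div_le_one hH).2 h1) ?_ ?_) <;> simp [hexVertex] <;> field_simp <;> ring
      · rw [abs_of_nonpos hy] at *
        refine hseg 5 (mem_segment_of_coord (t := (H + z.im) / H) (div_nonneg (by linarith) hH.le)
          ((div_le_one hH).2 (by linarith)) ?_ ?_) <;> simp [hexVertex] <;> field_simp <;> ring
    have hL : (⟨x - (W - κ * |z.im|), z.im⟩ : ℂ)
        ∈ convexHull ℝ (Set.range (hexVertex x κ W H)) := by
      rcases le_total 0 z.im with hy | hy
      · rw [abs_of_nonneg hy] at *
        refine hseg 2 (mem_segment_of_coord (t := (H - z.im) / H) (div_nonneg (by linarith) hH.le)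
          ((div_le_one hH).2 (by linarith)) ?_ ?_) <;> simp [hexVertex] <;> field_simp <;> ring
      · rw [abs_of_nonpos hy] at *
        refine hseg 3 (mem_segment_of_coord (t := -z.im / H) (div_nonneg (by linarith) hH.le)
          ((div_le_one hH).2 h4) ?_ ?_) <;> simp [hexVertex] <;> field_simp <;> ring
    have habs : |z.re - x| ≤ W - κ * |z.im| := by
      rcases abs_cases (z.re - x) with ⟨e, -⟩ | ⟨e, -⟩ <;>
        rcases abs_cases z.im with ⟨e', -⟩ | ⟨e', -⟩ <;> rw [e, e'] <;> linarith
    rw [abs_le] at habs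
    refine hcv.segment_subset hL hR (mem_segment_of_coord
      (t := (z.re - x + (W - κ * |z.im|)) / (2 * (W - κ * |z.im|)))
      (div_nonneg (by linarith) (by linarith)) ((div_le_one (by linarith)).2 (by linarith)) ?_ ?_)
    · field_simp
      ring
    · simp
  · refine convexHull_min ?_ convex_hexClosed
    rintro _ ⟨i, rfl⟩ j
    exact (hexForm_vertex hκ hH hW i j).1

/-- Only vertex i attains both bounds i and i - 1, so the sum of these two forms separates it
strictly from the other vertices. -/
theorem convexIndependent_hexVertex (hκ : 0 < κ) (hH : 0 < H) (hW : κ * H < W) :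
    ConvexIndependent ℝ (hexVertex x κ W H) := by
  rw [convexIndependent_iff_notMem_convexHull_sdiff]
  intro i s hi
  have hv := fun k j => hexForm_vertex (x := x) hκ hH hW k j
  let S : Set ℂ := {z | hexForm x κ i z + hexForm x κ (i - 1) z < hexBound W H i + hexBound W H (i - 1)}
  have hS : Convex ℝ S := by
    intro z hz w hw a b ha hb hab
    simp only [S, Set.mem_ofPred_eq] at hz hw ⊢
    rw [hexForm_combo x κ _ hab, hexForm_combo x κ _ hab]
    have e : ∀ c : ℝ, a * c + b * c = c := fun c => by rw [← add_mul, hab, one_mul]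
    have := e (hexBound W H i + hexBound W H (i - 1))
    rcases ha.eq_or_lt with rfl | ha
    · obtain rfl : b = 1 := by linarith
      linarith
    · have h1 := mul_lt_mul_of_pos_left hz ha
      have h2 := mul_le_mul_of_nonneg_left hw.le hb
      linarith
  have hsub : hexVertex x κ W H '' (s \ {i}) ⊆ S := by
    rintro _ ⟨j, ⟨-, hj⟩, rfl⟩
    have hj : j ≠ i := hj
    refine lt_of_le_of_ne (add_le_add (hv j i).1 (hv j (i - 1)).1) fun heq => ?_
    have h1 : hexForm x κ i (hexVertex x κ W H j) = hexBound W H i := by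
      linarith [(hv j i).1, (hv j (i - 1)).1]
    have h2 : hexForm x κ (i - 1) (hexVertex x κ W H j) = hexBound W H (i - 1) := by
      linarith [(hv j i).1, (hv j (i - 1)).1]
    rw [(hv j i).2] at h1
    rw [(hv j (i - 1)).2] at h2
    clear hv hS heq hi S
    revert i j
    decide
  have hmem := convexHull_min hsub hS hi
  have e1 := (hv i i).2.2 (Or.inl rfl)
  have e2 := (hv i (i - 1)).2.2 (Or.inr (by simp))
  simp only [S, Set.mem_ofPred_eq, e1, e2, lt_irrefl] at hmem

/-- Line i contains vertices i and i + 1 and no others, and this pair determines i. -/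
theorem injective_hexLine (hκ : 0 < κ) (hH : 0 < H) (hW : κ * H < W) :
    Function.Injective (hexLine x κ W H) := by
  intro i j hij
  have hv := fun k j => hexForm_vertex (x := x) hκ hH hW k j
  have h1 : hexVertex x κ W H i ∈ hexLine x κ W H j := by
    rw [← hij]; exact (hv i i).2.2 (Or.inl rfl)
  have h2 : hexVertex x κ W H (i + 1) ∈ hexLine x κ W H j := by
    rw [← hij]; exact (hv (i + 1) i).2.2 (Or.inr rfl)
  replace h1 := (hv i j).2.1 h1
  replace h2 := (hv (i + 1) j).2.1 h2
  clear hij hv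
  revert i j
  decide

theorem isHexagon_hexOpen (hκ : 0 < κ) (hH : 0 < H) (hW : κ * H < W) :
    IsHexagon (hexOpen x κ W H) (hexVertex x κ W H) (hexLine x κ W H) := by
  refine ⟨convexIndependent_hexVertex hκ hH hW, ?_, ?_, fun i => ?_⟩
  · rw [← hexClosed_eq_convexHull hκ hH hW, interior_hexClosed hκ hH hW]
  · simp_rw [← hexLine_inter_hexClosed (x := x) hκ hH hW]
    rw [frontier, closure_hexOpen hκ hH hW, isOpen_hexOpen.interior_eq]
    ext z
    simp only [Set.mem_sdiff, Set.mem_iUnion, Set.mem_inter_iff]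
    constructor
    · rintro ⟨hK, hO⟩
      have hO' : ¬ ∀ i, hexForm x κ i z < hexBound W H i := hO
      push Not at hO'
      obtain ⟨i, hi⟩ := hO'
      exact ⟨i, (hK i).antisymm hi, hK⟩
    · rintro ⟨i, hi, hK⟩
      exact ⟨hK, fun hO => (hO i).ne hi⟩
  · rw [closure_hexOpen hκ hH hW, hexLine_inter_hexClosed hκ hH hW]

/-- The region bounded by the lines of the edges, and by further lines that do not meet the open
hexagon, is the open hexagon. -/
theorem regionAround_eq_hexOpen (hκ : 0 < κ) (hH : 0 < H) (hW : κ * H < W) {𝓛 : Set (Set ℂ)}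
    (hℓ : ∀ i, hexLine x κ W H i ∈ 𝓛) (h𝓛 : ∀ ℓ ∈ 𝓛, Disjoint ℓ (hexOpen x κ W H)) :
    regionAround (x : ℂ) 𝓛 = hexOpen x κ W H := by
  have hc := center_mem_hexOpen (x := x) hκ hH hW
  have hsub : hexOpen x κ W H ⊆ (⋃₀ 𝓛)ᶜ := by
    rintro z hz ⟨ℓ, hℓ, hzℓ⟩
    exact Set.disjoint_left.1 (h𝓛 ℓ hℓ) hzℓ hz
  apply Set.Subset.antisymm
  -- Off the edge lines the closed hexagon reduces to the open one, so the connected component lies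
  -- in a union of two disjoint open sets.
  · have hcover : regionAround (x : ℂ) 𝓛 ⊆ hexOpen x κ W H ∪ (hexClosed x κ W H)ᶜ := by
      intro z hz
      by_cases hK : z ∈ hexClosed x κ W H
      · left
        intro i
        refine lt_of_le_of_ne (hK i) fun heq => ?_
        exact connectedComponentIn_subset _ _ hz ⟨_, hℓ i, heq⟩
      · exact Or.inr hK
    refine IsPreconnected.subset_left_of_subset_union isOpen_hexOpen
      isClosed_hexClosed.isOpen_compl ?_ hcover ?_ isPreconnected_connectedComponentIn
    · exact Set.disjoint_compl_right_iff_subset.2 hexOpen_subset_hexClosed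
    · exact ⟨_, mem_connectedComponentIn (hsub hc), hc⟩
  · exact convex_hexOpen.isPreconnected.subset_connectedComponentIn hc hsub

end Hexagon

/-! ### The bounding lines for p = q -/

theorem cos_two_pi_div (p : ℕ) :
    Real.cos (2 * Real.pi / p) = 1 - 2 * Real.sin (Real.pi / p) ^ 2 := by
  rw [mul_div_assoc, Real.cos_two_mul, Real.cos_sq']
  ring

theorem xi_eq (p : ℕ) : xi p = 2 * √(3 + Real.sin (Real.pi / p) ^ 2) := by
  rw [xi, cos_two_pi_div, ← Real.sqrt_mul zero_le_two]
  rw [show 2 * (7 - (1 - 2 * Real.sin (Real.pi / p) ^ 2))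
    = 2 ^ 2 * (3 + Real.sin (Real.pi / p) ^ 2) by ring, Real.sqrt_mul (by positivity),
    Real.sqrt_sq zero_le_two]

theorem rhoStarRe_self (p : ℕ) : rhoStarRe p p = 1 + Real.sin (Real.pi / p) ^ 2
    + Real.sin (Real.pi / p) * √(3 + Real.sin (Real.pi / p) ^ 2) := by
  rw [rhoStarRe, xi_eq]
  linear_combination Real.sin_sq_add_cos_sq (Real.pi / p)

theorem rhoStarIm_self (p : ℕ) : rhoStarIm p p = Real.cos (Real.pi / p)
    * (√(3 + Real.sin (Real.pi / p) ^ 2) + Real.sin (Real.pi / p)) := by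
  rw [rhoStarIm, xi_eq]
  ring

/-- Both sides simplify with ξ = 2√(3+s²): the numerator is 4 + 4s² + 4s√(3+s²), four times the
denominator. -/
theorem xStar_self {p : ℕ} (hp : 3 ≤ p) : xStar p p = 4 := by
  have hs := sin_pi_div_pos hp
  have hD : Real.cos (Real.pi / p) * Real.cos (Real.pi / p)
      + 1 / 2 * Real.sin (Real.pi / p) * (4 * Real.sin (Real.pi / p) + xi p)
      = 1 + Real.sin (Real.pi / p) ^ 2
        + Real.sin (Real.pi / p) * √(3 + Real.sin (Real.pi / p) ^ 2) := rhoStarRe_self p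
  rw [xStar, hD, sub_self, Real.cos_zero, cos_two_pi_div, xi_eq,
    show Real.pi / p - 2 * Real.pi / p = -(Real.pi / p) by ring, Real.sin_neg,
    div_eq_iff (by positivity)]
  ring

/-- The slope parameter of the slanted line through `ρ*_{p,p}` and `4`. -/
noncomputable def slantedSlope (p : ℕ) : ℝ :=
  (√(3 + Real.sin (Real.pi / p) ^ 2) - 2 * Real.sin (Real.pi / p)) / Real.cos (Real.pi / p)

theorem sin_pi_div_lt_one {p : ℕ} (hp : 3 ≤ p) : Real.sin (Real.pi / p) < 1 := by
  nlinarith [Real.sin_sq_add_cos_sq (Real.pi / p), sin_pi_div_pos hp,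
    mul_pos (cos_pi_div_pos hp) (cos_pi_div_pos hp)]

theorem two_sin_lt_sqrt {p : ℕ} (hp : 3 ≤ p) :
    2 * Real.sin (Real.pi / p) < √(3 + Real.sin (Real.pi / p) ^ 2) := by
  apply Real.lt_sqrt_of_sq_lt
  nlinarith [sin_pi_div_pos hp, sin_pi_div_lt_one hp]

theorem slantedSlope_pos {p : ℕ} (hp : 3 ≤ p) : 0 < slantedSlope p :=
  div_pos (sub_pos.2 (two_sin_lt_sqrt hp)) (cos_pi_div_pos hp)

theorem height_pos {p : ℕ} (hp : 3 ≤ p) : 0 < 2 * √(1 - Real.sin (Real.pi / p) ^ 4) := by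
  linarith [(sqrt_bounds hp).2, mul_pos (sin_pi_div_pos hp) (cos_pi_div_pos hp)]

/-- Since √(1-s⁴) = c√(1+s²), the cosine cancels, leaving (√(3+s²) - 2s)√(1+s²) < 2 - s² for 0 < s <
1. -/
theorem slantedSlope_mul_height_lt {p : ℕ} (hp : 3 ≤ p) :
    slantedSlope p * (2 * √(1 - Real.sin (Real.pi / p) ^ 4))
      < 4 - 2 * Real.sin (Real.pi / p) ^ 2 := by
  have hs := sin_pi_div_pos hp
  have hs1 := sin_pi_div_lt_one hp
  have hc := cos_pi_div_pos hp
  have hk := two_sin_lt_sqrt hp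
  have hcs := Real.sin_sq_add_cos_sq (Real.pi / p)
  rw [slantedSlope]
  generalize Real.sin (Real.pi / p) = s at *
  generalize Real.cos (Real.pi / p) = c at *
  have h4 : √(1 - s ^ 4) = c * √(1 + s ^ 2) := by
    rw [show 1 - s ^ 4 = c ^ 2 * (1 + s ^ 2) by rw [show c ^ 2 = 1 - s ^ 2 by linarith]; ring,
      Real.sqrt_mul (sq_nonneg c), Real.sqrt_sq hc.le]
  have hm : √(1 + s ^ 2) ≤ 1 + s ^ 2 / 2 := by
    apply Real.sqrt_le_iff.2 ⟨by positivity, ?_⟩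
    nlinarith [sq_nonneg (s ^ 2)]
  -- The tangent line of the square root at 3 + 1/16 = (7/4)².
  have hk' : √(3 + s ^ 2) ≤ 7 / 4 + (s ^ 2 - 1 / 16) * (2 / 7) := by
    apply Real.sqrt_le_iff.2 ⟨by nlinarith, ?_⟩
    nlinarith [sq_nonneg (s ^ 2 - 1 / 16)]
  have h1 : (√(3 + s ^ 2) - 2 * s) * √(1 + s ^ 2)
      ≤ (7 / 4 + (s ^ 2 - 1 / 16) * (2 / 7) - 2 * s) * (1 + s ^ 2 / 2) :=
    mul_le_mul (by linarith) hm (Real.sqrt_nonneg _) (by linarith)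
  have h2 : (7 / 4 + (s ^ 2 - 1 / 16) * (2 / 7) - 2 * s) * (1 + s ^ 2 / 2) < 2 - s ^ 2 := by
    have : s ^ 3 < 1 := pow_lt_one₀ hs.le hs1 (by norm_num)
    nlinarith [mul_pos hs hs, sq_nonneg (s - 1), mul_nonneg hs.le (sq_nonneg (s - 1)),
      mul_pos hs (sub_pos.2 this)]
  have e : (√(3 + s ^ 2) - 2 * s) / c * (2 * (c * √(1 + s ^ 2)))
      = 2 * ((√(3 + s ^ 2) - 2 * s) * √(1 + s ^ 2)) := by field_simp
  rw [h4, e]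
  linarith

theorem lineThrough_eq {a : ℂ} {κ x : ℝ} (ha : a.im ≠ 0) (h : a.re + κ * a.im = x) :
    lineThrough a x = {z | z.re + κ * z.im = x} := by
  ext z
  constructor
  · rintro ⟨t, rfl⟩
    rw [show (1 : ℂ) - t = ((1 - t : ℝ) : ℂ) by push_cast; rfl]
    simp only [Set.mem_ofPred_eq, add_re, add_im, re_ofReal_mul, im_ofReal_mul, ofReal_re,
      ofReal_im]
    linear_combination t * h
  · intro hz
    refine ⟨z.im / a.im, ?_⟩
    rw [show (1 : ℂ) - (z.im / a.im : ℝ) = ((1 - z.im / a.im : ℝ) : ℂ) by push_cast; rfl]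
    apply Complex.ext
    · simp only [add_re, re_ofReal_mul, ofReal_re]
      have hz : z.re + κ * z.im = x := hz
      field_simp
      linear_combination a.im * hz - z.im * h
    · simp only [add_im, im_ofReal_mul, ofReal_im]
      field_simp
      ring

theorem slantedLine_eq {p : ℕ} (hp : 3 ≤ p) :
    slantedLine p = {z | z.re + slantedSlope p * z.im = 4} := by
  have hs := sin_pi_div_pos hp
  have hc := cos_pi_div_pos hp
  have h := lineThrough_eq (a := rhoStar p p) (κ := slantedSlope p) (x := 4)
    (by change rhoStarIm p p ≠ 0; rw [rhoStarIm_self]; positivity)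
    (by
      -- With k = √(3+s²) the sum is 1 + s² + sk + (k - 2s)(k + s) = 1 - s² + k² = 4.
      change rhoStarRe p p + _ * rhoStarIm p p = 4
      rw [rhoStarIm_self, rhoStarRe_self, slantedSlope]
      have hk := Real.sq_sqrt (show 0 ≤ 3 + Real.sin (Real.pi / p) ^ 2 by positivity)
      field_simp
      linear_combination hk)
  exact h

theorem mem_conjSet {S : Set ℂ} {z : ℂ} : z ∈ conjSet S ↔ conj z ∈ S := by
  constructor
  · rintro ⟨w, hw, rfl⟩
    simpa using hw
  · exact fun h => ⟨_, h, conj_conj z⟩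

theorem mem_symSet {p q : ℕ} {S : Set ℂ} {z : ℂ} :
    z ∈ symSet p q S ↔ ((2 * symCenter p q : ℝ) : ℂ) - conj z ∈ S := by
  constructor
  · rintro ⟨w, hw, rfl⟩
    simpa only [map_sub, conj_conj, conj_ofReal, sub_sub_cancel] using hw
  · refine fun h => ⟨_, h, ?_⟩
    simp only [map_sub, conj_conj, conj_ofReal, sub_sub_cancel]

theorem hexagonLine_eq {p : ℕ} (hp : 3 ≤ p) : hexagonLine p
    = hexLine (symCenter p p) (slantedSlope p) (4 - symCenter p p)
      (2 * √(1 - Real.sin (Real.pi / p) ^ 4)) := by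
  funext i
  ext z
  fin_cases i <;>
    simp [hexagonLine, hexLine, hexForm, hexBound, slantedLine_eq hp, mem_symSet, mem_conjSet,
      horizontalLine] <;>
    constructor <;> intro h <;> linarith

theorem boundingLines_self {p : ℕ} (hp : 3 ≤ p) : boundingLines p p
    = {verticalLine 4, symSet p p (verticalLine 4)} ∪ Set.range (hexagonLine p) := by
  have h1 : (2 : ℝ) + 2 * Real.cos (Real.pi / p - Real.pi / p) = 4 := by
    rw [sub_self, Real.cos_zero]; norm_num
  have h2 : height p p = 2 * √(1 - Real.sin (Real.pi / p) ^ 4) := by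
    rw [height]; congr 2; ring
  have h3 : lineThrough (rhoStar p p) (xStar p p) = slantedLine p := by
    rw [xStar_self hp, slantedLine]; norm_num
  rw [boundingLines, h1, h2, h3, Set.union_assoc, Set.union_assoc, Set.union_self]
  congr 1
  ext S
  simp only [lineFamily, hexagonLine, Set.mem_union, Set.mem_insert_iff, Set.mem_singleton_iff,
    Set.mem_range, Fin.exists_fin_succ, Fin.exists_fin_zero]
  simp
  tauto

theorem mainTheorem4 (p : ℕ) (hp : 3 ≤ p) :
    regionOmega p p = regionAround (symCenter p p : ℂ) (Set.range (hexagonLine p)) ∧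
    Function.Injective (hexagonLine p) ∧
    ∃ v : Fin 6 → ℂ,
      IsHexagon (regionOmega p p) v (hexagonLine p) ∧
      ∀ i : Fin 6, ∃ ρ ∈ segment ℝ (v i) (v (i + 1)), IsCuspGroup p p ρ := by
  have hκ := slantedSlope_pos hp
  have hH := height_pos hp
  have hW : slantedSlope p * (2 * √(1 - Real.sin (Real.pi / p) ^ 4)) < 4 - symCenter p p := by
    rw [symCenter, mul_assoc, ← sq]
    exact slantedSlope_mul_height_lt hp
  have hx : symCenter p p = 2 * Real.sin (Real.pi / p) ^ 2 := by
    rw [symCenter]; ring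
  have hdisj : ∀ ℓ ∈ Set.range (hexagonLine p), Disjoint ℓ (hexOpen (symCenter p p)
      (slantedSlope p) (4 - symCenter p p) (2 * √(1 - Real.sin (Real.pi / p) ^ 4))) := by
    rw [hexagonLine_eq hp]
    rintro _ ⟨i, rfl⟩
    exact Set.disjoint_left.2 fun z hz hO => (hO i).ne hz
  have hregion := regionAround_eq_hexOpen hκ hH hW (𝓛 := Set.range (hexagonLine p))
    (fun i => by rw [hexagonLine_eq hp]; exact ⟨i, rfl⟩) hdisj
  have hΩ : regionOmega p p = hexOpen (symCenter p p) (slantedSlope p) (4 - symCenter p p)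
      (2 * √(1 - Real.sin (Real.pi / p) ^ 4)) := by
    rw [regionOmega, boundingLines_self hp]
    refine regionAround_eq_hexOpen hκ hH hW
      (fun i => by rw [hexagonLine_eq hp]; exact Or.inr ⟨i, rfl⟩) ?_
    rintro ℓ ((rfl | rfl) | hℓ)
    -- Forms 0 and 5 add up to Re z < 4 on the open hexagon, so this vertical line misses it.
    · refine Set.disjoint_left.2 fun z hz hO => ?_
      obtain ⟨h0, -, -, -, -, h5⟩ := mem_hexOpen_iff.1 hO
      have hz : z.re = 4 := hz
      linarith
    · refine Set.disjoint_left.2 fun z hz hO => ?_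
      obtain ⟨-, -, h2, h3, -, -⟩ := mem_hexOpen_iff.1 hO
      have hz : (((2 * symCenter p p : ℝ) : ℂ) - conj z).re = 4 := mem_symSet.1 hz
      rw [sub_re, ofReal_re, conj_re] at hz
      linarith
    · exact hdisj ℓ hℓ
  refine ⟨hΩ.trans hregion.symm, ?_, hexVertex (symCenter p p) (slantedSlope p)
    (4 - symCenter p p) (2 * √(1 - Real.sin (Real.pi / p) ^ 4)), ?_, ?_⟩
  · rw [hexagonLine_eq hp]
    exact injective_hexLine hκ hH hW
  · rw [hexagonLine_eq hp, hΩ]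
    exact isHexagon_hexOpen hκ hH hW
  · have hv₀ : hexVertex (symCenter p p) (slantedSlope p) (4 - symCenter p p)
        (2 * √(1 - Real.sin (Real.pi / p) ^ 4)) 0 = 4 := by
      apply Complex.ext <;> simp [hexVertex]
    have hv₃ : hexVertex (symCenter p p) (slantedSlope p) (4 - symCenter p p)
        (2 * √(1 - Real.sin (Real.pi / p) ^ 4)) 3
          = (4 * Real.sin (Real.pi / p) ^ 2 - 4 : ℝ) := by
      apply Complex.ext
      · simp only [hexVertex, Matrix.cons_val, ofReal_re]
        rw [hx]; ring
      · rw [ofReal_im]; rfl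
    intro i
    -- Slanted edges use a real vertex as cusp group, horizontal edges their midpoint.
    fin_cases i
    · exact ⟨4, hv₀ ▸ left_mem_segment ℝ _ _, isCuspGroup_four hp⟩
    · refine ⟨_, mem_segment_of_coord (t := 1 / 2) (by norm_num) (by norm_num) ?_ ?_,
        isCuspGroup_commutator hp⟩
      · simp [hexVertex, hx]; ring
      · simp [hexVertex]
    · exact ⟨_, hv₃ ▸ right_mem_segment ℝ _ _, isCuspGroup_neg_four_cos_sq hp⟩
    · exact ⟨_, hv₃ ▸ left_mem_segment ℝ _ _, isCuspGroup_neg_four_cos_sq hp⟩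
    · refine ⟨_, mem_segment_of_coord (t := 1 / 2) (by norm_num) (by norm_num) ?_ ?_,
        isCuspGroup_commutator_conj hp⟩
      · simp [hexVertex, hx]; ring
      · simp [hexVertex]
    · exact ⟨4, hv₀ ▸ right_mem_segment ℝ _ _, isCuspGroup_four hp⟩
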